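/- All graphs are finite, simple and connected. For a graph $G=(V,E)$ let $n=|V|$, $m=|E|$, let $e(u)=\max_{v\in V} dist(u,v)$ be the eccentricity of a vertex $u$, and $diam(G)=\max_{u\in V} e(u)$. A graph is chordal if each of its cycles of length at least four has a chord. A dominating triple of $G$ is a set $D$ of three vertices such that, for every connected subgraph $H$ of $G$ that contains all of $D$, every vertex of $G$ lies in $H$ or has a neighbour in $H$. $LexBFS(s)$, for a start vertex $s$, visits the vertices of $G$ one by one as follows: all labels are empty at first; $s$ is visited first; the $i$-th visited vertex receives the number $n+1-i$, and this number is appended to the label of each of its unvisited neighbours; the next vertex to be visited is any unvisited vertex with a lexicographically largest label (ties are broken arbitrarily). $3$-sweep LexBFS executes $LexBFS(s)$ from an arbitrary vertex $s$, then $LexBFS(u)$, where $u$ is the last vertex visited by the first execution, then $LexBFS(v)$, where $v$ is the last vertex visited by the second execution; let $w$ be the last vertex visited by the third execution. (The outputted vertex is $v$, whose eccentricity is given by the third execution; the claim is also made for $w$.) Theorem. Let $G$ be a chordal graph with a dominating triple, let $s,u,v,w$ arise from any execution of $3$-sweep LexBFS on $G$, and let $d\ge 10$. If $e(v)=d$,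 then $diam(G)=d$; likewise, if $e(w)=d$, then $diam(G)=d$. Moreover, there is an algorithm (a program for a unit-cost random access machine) that, given adjacency lists of a chordal graph with a dominating triple (the triple itself is not given), decides in time $O(n+m)$ whether $diam(G)\ge 10$. -/

import Mathlib

/-! ### Chordal graphs and dominating triples -/

namespace SimpleGraph

/-- A graph is chordal if every cycle of length at least four has a chord. -/
def IsChordal {V : Type*} (G : SimpleGraph V) : Prop :=
  ∀ ⦃v : V⦄ (p : G.Walk v v), p.IsCycle → 4 ≤ p.length →
    ∃ a ∈ p.support, ∃ b ∈ p.support, G.Adj a b ∧ s(a, b) ∉ p.edges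

/-- `S` is a dominating set of `G`: every vertex lies in `S` or has a neighbour in `S`. -/
def IsDominatingSet {V : Type*} (G : SimpleGraph V) (S : Set V) : Prop :=
  ∀ v : V, v ∈ S ∨ ∃ w ∈ S, G.Adj v w

/-- `D` is a dominating target of `G`: every connected subgraph of `G` that contains all of `D`
is dominating. -/
def IsDominatingTarget {V : Type*} (G : SimpleGraph V) (D : Set V) : Prop :=
  ∀ H : G.Subgraph, H.Connected → D ⊆ H.verts → G.IsDominatingSet H.verts

/-- `G` has a dominating triple, i.e. a dominating target of cardinality three. -/
def HasDominatingTriple {V : Type*} (G : SimpleGraph V) : Prop :=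
  ∃ D : Finset V, D.card = 3 ∧ G.IsDominatingTarget (D : Set V)

/-! ### Lexicographic breadth-first search -/

open Classical in
/-- The label of the vertex `y` after the vertices in the list `visited` have been visited, in this
order, by LexBFS on a graph with `n` vertices. The `j`-th visited vertex (counting from `j = 0`)
receives the number `n - j`, and this number is appended to the label of each of its neighbours. -/
noncomputable def lexLabel {V : Type*} (G : SimpleGraph V) (n : ℕ) (visited : List V) (y : V) :
    List ℕ :=
  visited.zipIdx.filterMap fun p => if G.Adj p.1 y then some (n - p.2) else none

/-- `ord` lists the vertices in the order in which some execution of LexBFS with start vertex `s`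
visits them (ties are broken arbitrarily): `s` is visited first, and each further visited vertex has
a lexicographically largest label among the vertices not visited yet. -/
def IsLexBFS {V : Type*} [Fintype V] (G : SimpleGraph V) (s : V) (ord : List V) : Prop :=
  ord.Nodup ∧ (∀ v : V, v ∈ ord) ∧ ord.head? = some s ∧
    ∀ (k : ℕ) (hk : k < ord.length), 0 < k → ∀ y ∉ ord.take k,
      G.lexLabel (Fintype.card V) (ord.take k) y ≤ G.lexLabel (Fintype.card V) (ord.take k) ord[k]

/-- Some execution of LexBFS with start vertex `s` visits the vertex `u` last. -/
def LexBFSLast {V : Type*} [Fintype V] (G : SimpleGraph V) (s u : V) : Prop :=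
  ∃ ord : List V, G.IsLexBFS s ord ∧ ord.getLast? = some u

/-- An execution of `3`-sweep LexBFS: three consecutive executions of LexBFS, the first from an
arbitrary vertex `s`, the second from the vertex `u` visited last by the first, the third from the
vertex `v` visited last by the second; `w` is the vertex visited last by the third. -/
def ThreeSweepLexBFS {V : Type*} [Fintype V] (G : SimpleGraph V) (s u v w : V) : Prop :=
  G.LexBFSLast s u ∧ G.LexBFSLast u v ∧ G.LexBFSLast v w

end SimpleGraph

/-! ### A random access machine with unit cost

Programs use finitely many registers and finitely many arrays of natural numbers. Arithmetic is
limited to successor and predecessor, so in `t` steps the largest number in memory grows by at most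
`t` (beyond the constants of the program): unit cost is legitimate, and words of logarithmically
many bits suffice for computations of linear (or polynomial) length. -/

namespace RAM

/-- Memory: registers `reg r` and arrays `arr a`, with entries `arr a i`. -/
structure State where
  reg : ℕ → ℕ
  arr : ℕ → ℕ → ℕ

/-- Assign the value `x` to the register `r`. -/
def State.setReg (σ : State) (r x : ℕ) : State :=
  { σ with reg := Function.update σ.reg r x }

/-- Assign the value `x` to the entry `i` of the array `a`. -/
def State.setArr (σ : State) (a i x : ℕ) : State :=
  { σ with arr := Function.update σ.arr a (Function.update (σ.arr a) i x) }

/-- Comparisons of the contents of two registers. -/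
inductive Test : Type
  | eq (r s : ℕ)
  | ne (r s : ℕ)
  | lt (r s : ℕ)
  | le (r s : ℕ)

/-- The truth of a test in a given state. -/
def Test.Holds : Test → State → Prop
  | .eq r s, σ => σ.reg r = σ.reg s
  | .ne r s, σ => σ.reg r ≠ σ.reg s
  | .lt r s, σ => σ.reg r < σ.reg s
  | .le r s, σ => σ.reg r ≤ σ.reg s

/-- Programs. The names of registers and arrays are fixed in the program text; the indices of array
entries are contents of registers. -/
inductive Prog : Type
  /-- do nothing -/
  | skip
  /-- `reg r := c` -/
  | const (r c : ℕ)
  /-- `reg r := reg s` -/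
  | copy (r s : ℕ)
  /-- `reg r := reg s + 1` -/
  | succ (r s : ℕ)
  /-- `reg r := reg s - 1`, where `0 - 1 = 0` -/
  | pred (r s : ℕ)
  /-- `reg r := arr a (reg i)` -/
  | load (r a i : ℕ)
  /-- `arr a (reg i) := reg s` -/
  | store (a i s : ℕ)
  /-- run `p`, then `q` -/
  | seq (p q : Prog)
  /-- run `p` if the test holds, else `q` -/
  | ite (b : Test) (p q : Prog)
  /-- run `p` as long as the test holds -/
  | loop (b : Test) (p : Prog)

/-- `Exec p σ t τ`: started in the state `σ`, the program `p` halts in the state `τ` after exactly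
`t` steps. Each assignment, each memory access, each `skip` and each evaluation of a test is one
step. -/
inductive Exec : Prog → State → ℕ → State → Prop
  | skip (σ : State) : Exec .skip σ 1 σ
  | const (σ : State) (r c : ℕ) : Exec (.const r c) σ 1 (σ.setReg r c)
  | copy (σ : State) (r s : ℕ) : Exec (.copy r s) σ 1 (σ.setReg r (σ.reg s))
  | succ (σ : State) (r s : ℕ) : Exec (.succ r s) σ 1 (σ.setReg r (σ.reg s + 1))
  | pred (σ : State) (r s : ℕ) : Exec (.pred r s) σ 1 (σ.setReg r (σ.reg s - 1))
  | load (σ : State) (r a i : ℕ) : Exec (.load r a i) σ 1 (σ.setReg r (σ.arr a (σ.reg i)))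
  | store (σ : State) (a i s : ℕ) : Exec (.store a i s) σ 1 (σ.setArr a (σ.reg i) (σ.reg s))
  | seq {p q : Prog} {σ τ ρ : State} {t₁ t₂ : ℕ} (h₁ : Exec p σ t₁ τ) (h₂ : Exec q τ t₂ ρ) :
      Exec (.seq p q) σ (t₁ + t₂) ρ
  | iteTrue {b : Test} {p q : Prog} {σ τ : State} {t : ℕ} (hb : b.Holds σ) (h : Exec p σ t τ) :
      Exec (.ite b p q) σ (t + 1) τ
  | iteFalse {b : Test} {p q : Prog} {σ τ : State} {t : ℕ} (hb : ¬ b.Holds σ) (h : Exec q σ t τ) :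
      Exec (.ite b p q) σ (t + 1) τ
  | loopTrue {b : Test} {p : Prog} {σ τ ρ : State} {t₁ t₂ : ℕ} (hb : b.Holds σ)
      (h₁ : Exec p σ t₁ τ) (h₂ : Exec (.loop b p) τ t₂ ρ) : Exec (.loop b p) σ (t₁ + t₂ + 1) ρ
  | loopFalse {b : Test} {p : Prog} {σ : State} (hb : ¬ b.Holds σ) : Exec (.loop b p) σ 1 σ

/-! ### Graphs as inputs -/

/-- `L` is an adjacency-list representation of `G`: `L v` lists the neighbours of `v`, each of them
once, in any order. -/
def IsAdjacencyLists {n : ℕ} (G : SimpleGraph (Fin n)) (L : Fin n → List (Fin n)) : Prop :=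
  ∀ v : Fin n, (L v).Nodup ∧ ∀ w : Fin n, w ∈ L v ↔ G.Adj v w

/-- The initial memory for the adjacency lists `L`. Register `0` holds the number `n` of vertices.
Array `1` holds the lists `L 0, L 1, …, L (n - 1)`, one after the other, and the entry `i ≤ n` of
array `0` is the position in array `1` where the list `L i` starts (for `i = n`, the position after
the last entry). Everything else is `0`. -/
def inputState {n : ℕ} (L : Fin n → List (Fin n)) : State where
  reg r := if r = 0 then n else 0
  arr a i :=
    if a = 0 then (if i ≤ n then ((List.ofFn L).take i).flatten.length else 0)
    else if a = 1 then ((List.ofFn L).flatten.map Fin.val).getD i 0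
    else 0

open Classical in
/-- On the class `C` of graphs, the property `Q` is decided in linear time, i.e. in time
`O(n + m)` for graphs with `n` vertices and `m` edges: one program, given any adjacency-list
representation of any graph in `C`, halts within `c * (n + m)` steps, with answer `1` (`Q` holds) or
`0` (`Q` fails) in register `0`. Nothing is required on graphs outside `C`. -/
def DecidableInLinearTime (C Q : ∀ n : ℕ, SimpleGraph (Fin n) → Prop) : Prop :=
  ∃ (p : Prog) (c : ℕ), ∀ (n : ℕ) (G : SimpleGraph (Fin n)), C n G →
    ∀ L : Fin n → List (Fin n), IsAdjacencyLists G L →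
      ∃ (t : ℕ) (τ : State), Exec p (inputState L) t τ ∧ t ≤ c * (n + G.edgeSet.ncard) ∧
        τ.reg 0 = if Q n G then 1 else 0

end RAM

namespace SimpleGraph

section Walks

variable {V : Type*} {G : SimpleGraph V}

/-- A shortest walk has no chord. -/
lemma Walk.mem_edges_of_length_eq_dist {x y a b : V} (p : G.Walk x y)
    (hp : p.length = G.dist x y) (ha : a ∈ p.support) (hb : b ∈ p.support) (hab : G.Adj a b) :
    s(a, b) ∈ p.edges := by
  obtain ⟨i, rfl, hi⟩ := Walk.mem_support_iff_exists_getVert.1 ha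
  obtain ⟨j, rfl, hj⟩ := Walk.mem_support_iff_exists_getVert.1 hb
  have key : ∀ i j, i ≤ p.length → j ≤ p.length → i < j → G.Adj (p.getVert i) (p.getVert j) →
      s(p.getVert i, p.getVert j) ∈ p.edges := by
    intro i j hi hj hij h
    have h1 : G.dist x y ≤ i + 1 + (p.length - j) := by
      have := G.dist_le ((p.take i).append (Walk.cons h (p.drop j)))
      simp only [Walk.length_append, Walk.length_cons, Walk.take_length, Walk.drop_length] at this
      omega
    have h2 : j = i + 1 := by omega
    subst h2
    exact (Walk.mk_mem_edges_iff_exists p).2 ⟨i, by omega, rfl⟩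
  rcases lt_trichotomy i j with h | h | h
  · exact key i j hi hj h hab
  · subst h; exact absurd hab (G.loopless.irrefl _)
  · rw [Sym2.eq_swap]; exact key j i hj hi h hab.symm

/-- A walk inside a set of vertices can be replaced by a chordless path inside that set. -/
lemma Walk.exists_chordless {S : Set V} {x y : V} (p : G.Walk x y) (hp : ∀ v ∈ p.support, v ∈ S) :
    ∃ q : G.Walk x y, q.IsPath ∧ (∀ v ∈ q.support, v ∈ S) ∧
      ∀ a ∈ q.support, ∀ b ∈ q.support, G.Adj a b → s(a, b) ∈ q.edges := by
  have hr : (G.induce S).Reachable ⟨x, hp x p.start_mem_support⟩ ⟨y, hp y p.end_mem_support⟩ :=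
    ⟨p.induce S hp⟩
  obtain ⟨w, hw⟩ := hr.exists_walk_length_eq_dist
  have key : ∀ (f : G.induce S ↪g G) (_ : ∀ a, f a = a.1) {a b : S} (w : (G.induce S).Walk a b),
      w.length = (G.induce S).dist a b →
      ∃ q : G.Walk (f a) (f b), q.IsPath ∧ (∀ v ∈ q.support, v ∈ S) ∧
        ∀ a ∈ q.support, ∀ b ∈ q.support, G.Adj a b → s(a, b) ∈ q.edges := by
    intro f hf a b w hw
    refine ⟨w.map f.toHom, Walk.IsPath.map f.injective (w.isPath_of_length_eq_dist hw), ?_, ?_⟩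
    · intro v hv
      rw [Walk.support_map, List.mem_map] at hv
      obtain ⟨a, -, rfl⟩ := hv
      exact (hf a).symm ▸ a.2
    · intro a ha b hb hab
      rw [Walk.support_map, List.mem_map] at ha hb
      obtain ⟨a, ha, rfl⟩ := ha
      obtain ⟨b, hb, rfl⟩ := hb
      rw [Walk.edges_map]
      exact List.mem_map_of_mem (f := Sym2.map f)
        (w.mem_edges_of_length_eq_dist hw ha hb (f.map_adj_iff.1 hab))
  exact key (Embedding.induce S) (fun _ => rfl) w hw

/-- A walk that ends in `P` has a first vertex in `P`. -/
lemma Walk.exists_first {x y : V} (p : G.Walk x y) {P : V → Prop} (hy : P y) :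
    ∃ (z : V) (q : G.Walk x z), P z ∧ (∀ v ∈ q.support, v ∈ p.support) ∧
      ∀ v ∈ q.support, v ≠ z → ¬ P v := by
  induction p with
  | nil => exact ⟨_, Walk.nil, hy, by simp, by simp⟩
  | @cons u v w h p ih =>
    by_cases hu : P u
    · exact ⟨u, Walk.nil, hu, by simp, by simp⟩
    · obtain ⟨z, q, hz, hq, hq'⟩ := ih hy
      refine ⟨z, Walk.cons h q, hz, ?_, ?_⟩
      · intro t ht
        simp only [Walk.support_cons, List.mem_cons] at ht ⊢
        exact ht.imp_right (hq t)
      · intro t ht htz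
        simp only [Walk.support_cons, List.mem_cons] at ht
        rcases ht with rfl | ht
        · exact hu
        · exact hq' t ht htz

/-- A walk from outside `P` into `P` enters `P` by an edge. -/
lemma Walk.exists_first_edge {x y : V} (p : G.Walk x y) {P : V → Prop} (hx : ¬ P x)
    (hy : ∃ v ∈ p.support, P v) :
    ∃ (a b : V) (q : G.Walk x a) (r : G.Walk b y), (∀ v ∈ q.support, ¬ P v) ∧ G.Adj a b ∧ P b ∧
      p.length = q.length + 1 + r.length := by
  induction p with
  | nil => simp only [Walk.support_nil, List.mem_singleton, exists_eq_left] at hy; exact absurd hy hx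
  | @cons u v w h p ih =>
    by_cases hv : P v
    · exact ⟨u, v, Walk.nil, p, by simpa using hx, h, hv, by simp [add_comm]⟩
    · obtain ⟨t, ht, hPt⟩ := hy
      have ht' : t ∈ p.support := by
        simp only [Walk.support_cons, List.mem_cons] at ht
        rcases ht with rfl | ht
        · exact absurd hPt hx
        · exact ht
      obtain ⟨a, b, q, r, hq, hab, hb, hl⟩ := ih hv ⟨t, ht', hPt⟩
      refine ⟨a, b, Walk.cons h q, r, ?_, hab, hb, by simp [hl]; omega⟩
      intro z hz
      simp only [Walk.support_cons, List.mem_cons] at hz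
      rcases hz with rfl | hz
      · exact hx
      · exact hq z hz

/-- In a chordal graph, two vertices that are joined by two walks with non-touching interiors are
adjacent. -/
theorem IsChordal.adj_of_walks (hG : G.IsChordal) {x y : V} (hxy : x ≠ y) {A B : Set V}
    (p : G.Walk x y) (hp : ∀ v ∈ p.support, v = x ∨ v = y ∨ v ∈ A)
    (q : G.Walk x y) (hq : ∀ v ∈ q.support, v = x ∨ v = y ∨ v ∈ B)
    (hAB : ∀ a ∈ A, ∀ b ∈ B, a ≠ b ∧ ¬ G.Adj a b) : G.Adj x y := by
  by_contra hna
  obtain ⟨p, hpp, hp, hpc⟩ := p.exists_chordless (S := {v | v = x ∨ v = y ∨ v ∈ A}) hp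
  obtain ⟨q, hqp, hq, hqc⟩ := q.exists_chordless (S := {v | v = x ∨ v = y ∨ v ∈ B}) hq
  simp only [Set.mem_ofPred_eq] at hp hq
  have hlen : ∀ r : G.Walk x y, 2 ≤ r.length := by
    intro r
    have h0 : r.length ≠ 0 := fun h => hxy (Walk.eq_of_length_eq_zero h)
    have h1 : r.length ≠ 1 := fun h => hna (Walk.adj_of_length_eq_one h)
    omega
  have hcyc : (p.append q.reverse).IsCycle := by
    refine hpp.isCycle_append hqp.reverse ?_ (Or.inl (hlen p))
    rw [List.disjoint_left]
    intro v hv hv'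
    have h1 : v ≠ x := by
      rintro rfl
      have := hpp.support_nodup
      rw [← Walk.cons_tail_support] at this
      exact (List.nodup_cons.1 this).1 hv
    have h2 : v ≠ y := by
      rintro rfl
      have := hqp.reverse.support_nodup
      rw [← Walk.cons_tail_support] at this
      exact (List.nodup_cons.1 this).1 hv'
    have h3 : v ∈ q.support := by
      have := List.mem_of_mem_tail hv'
      simpa using this
    have h4 := hp v (List.mem_of_mem_tail hv)
    have h5 := hq v h3
    simp only [h1, h2, false_or] at h4 h5
    exact (hAB v h4 v h5).1 rfl
  obtain ⟨a, ha, b, hb, hab, hc⟩ := hG _ hcyc (by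
    have := hlen p; have := hlen q
    simp; omega)
  simp only [Walk.mem_support_append_iff, Walk.support_reverse, List.mem_reverse] at ha hb
  simp only [Walk.edges_append, Walk.edges_reverse, List.mem_append, List.mem_reverse,
    not_or] at hc
  have key : ∀ a b, a ∈ p.support → b ∈ q.support → G.Adj a b → s(a, b) ∉ p.edges →
      s(a, b) ∉ q.edges → False := by
    intro a b ha hb hab h1 h2
    have hap : b ∉ p.support := fun hb' => h1 (hpc a ha b hb' hab)
    have hbq : a ∉ q.support := fun ha' => h2 (hqc a ha' b hb hab)
    rcases hp a ha with rfl | rfl | haA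
    · exact hbq q.start_mem_support
    · exact hbq q.end_mem_support
    rcases hq b hb with rfl | rfl | hbB
    · exact hap p.start_mem_support
    · exact hap p.end_mem_support
    exact (hAB a haA b hbB).2 hab
  rcases ha with ha | ha <;> rcases hb with hb | hb
  · exact hc.1 (hpc a ha b hb hab)
  · exact key a b ha hb hab hc.1 hc.2
  · exact key b a hb ha hab.symm (by rw [Sym2.eq_swap]; exact hc.1)
      (by rw [Sym2.eq_swap]; exact hc.2)
  · exact hc.2 (hqc a ha b hb hab)

end Walks

end SimpleGraph

namespace SimpleGraph

section Layers

variable {V : Type*} {G : SimpleGraph V} {s : V}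

lemma Connected.dist_le_succ_of_adj (hc : G.Connected) (s : V) {a b : V} (h : G.Adj a b) :
    G.dist s a ≤ G.dist s b + 1 := by
  have h1 := hc.dist_triangle (u := s) (v := b) (w := a)
  have h2 := dist_eq_one_iff_adj.2 h.symm
  omega

lemma Connected.exists_adj_dist_pred (hc : G.Connected) {s z : V} (h : G.dist s z ≠ 0) :
    ∃ y, G.Adj y z ∧ G.dist s y + 1 = G.dist s z := by
  obtain ⟨w, hw⟩ := hc.exists_walk_length_eq_dist z s
  rw [dist_comm] at hw
  cases w with
  | nil => simp at h
  | @cons _ y _ hzy w =>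
    refine ⟨y, hzy.symm, ?_⟩
    have h1 := G.dist_le w
    have h2 := hc.dist_le_succ_of_adj s hzy
    rw [Walk.length_cons] at hw
    rw [dist_comm] at h1
    omega

/-- The vertices of the `i`-th layer around `s` that lie on a geodesic from `s` to `x`. -/
def shadow (G : SimpleGraph V) (s : V) (i : ℕ) (x : V) : Set V :=
  {p | G.dist s p = i ∧ i + G.dist p x = G.dist s x}

/-- `x` and `y` are joined by a walk in the layers `≥ i` around `s`. -/
def JoinedAbove (G : SimpleGraph V) (s : V) (i : ℕ) (x y : V) : Prop :=
  ∃ w : G.Walk x y, ∀ v ∈ w.support, i ≤ G.dist s v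

/-- Some vertex of `A` equals or is adjacent to some vertex of `B`. -/
def Touch (G : SimpleGraph V) (A B : Set V) : Prop :=
  ∃ a ∈ A, ∃ b ∈ B, a = b ∨ G.Adj a b

lemma Touch.symm {A B : Set V} (h : G.Touch A B) : G.Touch B A := by
  obtain ⟨a, ha, b, hb, h⟩ := h
  exact ⟨b, hb, a, ha, h.imp Eq.symm Adj.symm⟩

lemma Connected.eq_or_adj_iff (hc : G.Connected) {a b : V} :
    (a = b ∨ G.Adj a b) ↔ G.dist a b ≤ 1 := by
  constructor
  · rintro (rfl | h)
    · simp
    · exact (dist_eq_one_iff_adj.2 h).le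
  · intro h
    by_cases h0 : G.dist a b = 0
    · exact Or.inl (hc.dist_eq_zero_iff.1 h0)
    · exact Or.inr (dist_eq_one_iff_adj.1 (by omega))

lemma mem_shadow_self (x : V) : x ∈ G.shadow s (G.dist s x) x := by simp [shadow]

lemma mem_shadow_dist_eq {x p : V} (hc : G.Connected) (h : p ∈ G.shadow s (G.dist s x) x) :
    p = x := by
  have : G.dist p x = 0 := by have := h.2; omega
  exact hc.dist_eq_zero_iff.1 this

lemma mem_shadow_of_adj (hc : G.Connected) {i : ℕ} {x p q : V} (hp : p ∈ G.shadow s (i + 1) x)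
    (hpq : G.Adj q p) (hq : G.dist s q = i) : q ∈ G.shadow s i x := by
  refine ⟨hq, ?_⟩
  have h1 := hp.2
  have h2 := hc.dist_triangle (u := s) (v := q) (w := x)
  have h3 := hc.dist_le_succ_of_adj x hpq
  rw [dist_comm, dist_comm (u := x)] at h3
  omega

lemma exists_adj_of_mem_shadow (hc : G.Connected) {i : ℕ} {x q : V} (hq : q ∈ G.shadow s i x)
    (hi : i < G.dist s x) : ∃ p ∈ G.shadow s (i + 1) x, G.Adj q p := by
  obtain ⟨h1, h2⟩ := hq
  have h0 : G.dist x q ≠ 0 := by rw [dist_comm]; omega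
  obtain ⟨p, hpq, hp⟩ := hc.exists_adj_dist_pred h0
  refine ⟨p, ?_, hpq.symm⟩
  have h3 := hc.dist_le_succ_of_adj s hpq
  have h4 := hc.dist_triangle (u := s) (v := p) (w := x)
  rw [dist_comm, dist_comm (u := x)] at hp
  constructor <;> omega

lemma shadow_nonempty (hc : G.Connected) {i : ℕ} {x : V} (hi : i ≤ G.dist s x) :
    (G.shadow s i x).Nonempty := by
  induction hi using Nat.decreasingInduction with
  | self => exact ⟨x, mem_shadow_self x⟩
  | of_succ i hi ih =>
    obtain ⟨p, hp⟩ := ih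
    obtain ⟨q, hqp, hq⟩ := hc.exists_adj_dist_pred (s := s) (z := p) (by rw [hp.1]; omega)
    exact ⟨q, mem_shadow_of_adj hc hp hqp (by have := hp.1; omega)⟩

namespace JoinedAbove

variable {i j : ℕ} {x y z : V}

lemma left_le (h : G.JoinedAbove s i x y) : i ≤ G.dist s x :=
  h.choose_spec x (Walk.start_mem_support _)

lemma right_le (h : G.JoinedAbove s i x y) : i ≤ G.dist s y :=
  h.choose_spec y (Walk.end_mem_support _)

lemma refl (h : i ≤ G.dist s x) : G.JoinedAbove s i x x := ⟨Walk.nil, by simpa using h⟩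

lemma symm (h : G.JoinedAbove s i x y) : G.JoinedAbove s i y x := by
  obtain ⟨w, hw⟩ := h
  exact ⟨w.reverse, by simpa using hw⟩

lemma trans (h : G.JoinedAbove s i x y) (h' : G.JoinedAbove s i y z) : G.JoinedAbove s i x z := by
  obtain ⟨w, hw⟩ := h
  obtain ⟨w', hw'⟩ := h'
  refine ⟨w.append w', fun v hv => ?_⟩
  rcases (Walk.mem_support_append_iff _ _).1 hv with hv | hv
  · exact hw v hv
  · exact hw' v hv

lemma mono (h : G.JoinedAbove s i x y) (hj : j ≤ i) : G.JoinedAbove s j x y := by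
  obtain ⟨w, hw⟩ := h
  exact ⟨w, fun v hv => hj.trans (hw v hv)⟩

lemma of_adj (h : G.Adj x y) (hx : i ≤ G.dist s x) (hy : i ≤ G.dist s y) :
    G.JoinedAbove s i x y :=
  ⟨h.toWalk, by simp [hx, hy]⟩

end JoinedAbove

lemma joinedAbove_of_mem_shadow (hc : G.Connected) {i : ℕ} {x p : V} (hi : i ≤ G.dist s x)
    (hp : p ∈ G.shadow s i x) : G.JoinedAbove s i p x := by
  induction hi using Nat.decreasingInduction generalizing p with
  | self =>
    rw [mem_shadow_dist_eq hc hp]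
    exact JoinedAbove.refl le_rfl
  | of_succ i hi ih =>
    obtain ⟨q, hq, hpq⟩ := exists_adj_of_mem_shadow hc hp hi
    refine JoinedAbove.trans (JoinedAbove.of_adj hpq ?_ ?_) ((ih hq).mono (by omega))
    · have := hp.1; omega
    · have := hq.1; omega

lemma Connected.exists_walk_down (hc : G.Connected) (s z : V) :
    ∃ w : G.Walk z s, ∀ v ∈ w.support, v = z ∨ G.dist s v < G.dist s z := by
  induction hn : G.dist s z generalizing z with
  | zero =>
    obtain rfl := hc.dist_eq_zero_iff.1 hn
    exact ⟨Walk.nil, by simp⟩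
  | succ n ih =>
    obtain ⟨y, hyz, hy⟩ := hc.exists_adj_dist_pred (s := s) (z := z) (by omega)
    obtain ⟨w, hw⟩ := ih y (by omega)
    refine ⟨Walk.cons hyz.symm w, fun v hv => ?_⟩
    simp only [Walk.support_cons, List.mem_cons] at hv
    rcases hv with rfl | hv
    · exact Or.inl rfl
    · rcases hw v hv with rfl | h
      · right; omega
      · right; omega

/-- In a chordal graph, the lower neighbours of a connected set of higher layers form a clique. -/
lemma IsChordal.eq_or_adj_of_joinedAbove (hG : G.IsChordal) (hc : G.Connected) {i : ℕ}
    {y y' z z' : V} (hz : G.dist s z = i) (hz' : G.dist s z' = i) (hzy : G.Adj z y)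
    (hzy' : G.Adj z' y') (h : G.JoinedAbove s (i + 1) y y') : z = z' ∨ G.Adj z z' := by
  by_contra! hne
  obtain ⟨w, hw⟩ := h
  obtain ⟨w₁, hw₁⟩ := hc.exists_walk_down s z
  obtain ⟨w₂, hw₂⟩ := hc.exists_walk_down s z'
  refine hne.2 (hG.adj_of_walks hne.1 (A := {v | i < G.dist s v}) (B := {v | G.dist s v < i})
    (Walk.cons hzy (w.append (Walk.cons hzy'.symm Walk.nil))) ?_
    (w₁.append w₂.reverse) ?_ ?_)
  · intro v hv
    simp only [Walk.support_cons, List.mem_cons, Walk.mem_support_append_iff, Walk.support_nil,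
      List.not_mem_nil, or_false] at hv
    rcases hv with rfl | hv | rfl | rfl
    · simp
    · exact Or.inr (Or.inr (hw v hv))
    · exact Or.inr (Or.inr (hw _ (Walk.end_mem_support _)))
    · simp
  · intro v hv
    simp only [Walk.mem_support_append_iff, Walk.support_reverse, List.mem_reverse] at hv
    rcases hv with hv | hv
    · rcases hw₁ v hv with rfl | h
      · simp
      · exact Or.inr (Or.inr (by simpa [hz] using h))
    · rcases hw₂ v hv with rfl | h
      · simp
      · exact Or.inr (Or.inr (by simpa [hz'] using h))
  · intro a ha b hb
    simp only [Set.mem_ofPred_eq] at ha hb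
    refine ⟨fun h => by subst h; omega, fun h => ?_⟩
    have := hc.dist_le_succ_of_adj s h
    omega

/-- In a chordal graph, if two vertices of a layer have neighbours in a connected set of higher
layers, then they have a common neighbour on any walk joining these neighbours. -/
lemma IsChordal.exists_common_adj (hG : G.IsChordal) (hc : G.Connected) {i : ℕ}
    {y y' z z' : V} (hz : G.dist s z = i) (hz' : G.dist s z' = i) (hzy : G.Adj z y)
    (hzy' : G.Adj z' y') (w : G.Walk y y') (hw : ∀ v ∈ w.support, i + 1 ≤ G.dist s v) :
    ∃ v ∈ w.support, G.Adj z v ∧ G.Adj z' v := by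
  rcases hG.eq_or_adj_of_joinedAbove hc hz hz' hzy hzy' ⟨w, hw⟩ with rfl | hzz
  · exact ⟨y, w.start_mem_support, hzy, hzy⟩
  obtain ⟨v, q, hv, hq, hqv⟩ := w.exists_first (P := fun v => G.Adj z' v) hzy'
  refine ⟨v, hq v q.end_mem_support, ?_, hv⟩
  have hne : z ≠ v := by
    rintro rfl
    have := hw _ (hq _ q.end_mem_support)
    omega
  refine hG.adj_of_walks hne (A := {t | ¬ G.Adj z' t ∧ t ≠ z'}) (B := {z'})
    (Walk.cons hzy q) ?_ (Walk.cons hzz (Walk.cons hv Walk.nil)) ?_ ?_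
  · intro t ht
    simp only [Walk.support_cons, List.mem_cons] at ht
    rcases ht with rfl | ht
    · simp
    · by_cases htv : t = v
      · simp [htv]
      · refine Or.inr (Or.inr ⟨hqv t ht htv, ?_⟩)
        rintro rfl
        have := hw _ (hq _ ht)
        omega
  · intro t ht
    simp at ht
    simp only [Set.mem_singleton_iff]
    tauto
  · rintro a ⟨ha, ha'⟩ b rfl
    exact ⟨ha', fun h => ha h.symm⟩

/-- Shadows are cliques; more generally, so are the shadows of vertices joined above. -/
lemma IsChordal.eq_or_adj_of_mem_shadow (hG : G.IsChordal) (hc : G.Connected) {i : ℕ}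
    {x x' z z' : V} (h : G.JoinedAbove s (i + 1) x x') (hz : z ∈ G.shadow s i x)
    (hz' : z' ∈ G.shadow s i x') : z = z' ∨ G.Adj z z' := by
  obtain ⟨y, hy, hzy⟩ := exists_adj_of_mem_shadow hc hz h.left_le
  obtain ⟨y', hy', hzy'⟩ := exists_adj_of_mem_shadow hc hz' h.right_le
  exact hG.eq_or_adj_of_joinedAbove hc hz.1 hz'.1 hzy hzy'
    (((joinedAbove_of_mem_shadow hc h.left_le hy).trans h).trans
      (joinedAbove_of_mem_shadow hc h.right_le hy').symm)

lemma IsChordal.eq_or_adj_of_mem_shadow_self (hG : G.IsChordal) (hc : G.Connected) {i : ℕ}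
    {x z z' : V} (hi : i ≤ G.dist s x) (hz : z ∈ G.shadow s i x)
    (hz' : z' ∈ G.shadow s i x) : z = z' ∨ G.Adj z z' := by
  rcases hi.eq_or_lt with rfl | hi
  · left; rw [mem_shadow_dist_eq hc hz, mem_shadow_dist_eq hc hz']
  · exact hG.eq_or_adj_of_mem_shadow hc (JoinedAbove.refl hi) hz hz'

/-- Adjacent vertices of a layer have a common lower neighbour. -/
lemma IsChordal.exists_common_lower (hG : G.IsChordal) (hc : G.Connected) {i : ℕ} {y y' : V}
    (hy : G.dist s y = i + 1) (hy' : G.dist s y' = i + 1) (h : y = y' ∨ G.Adj y y') :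
    ∃ z, G.dist s z = i ∧ G.Adj z y ∧ G.Adj z y' := by
  obtain ⟨z, hzy, hz⟩ := hc.exists_adj_dist_pred (s := s) (z := y) (by omega)
  obtain ⟨z', hzy', hz'⟩ := hc.exists_adj_dist_pred (s := s) (z := y') (by omega)
  rcases h with rfl | h
  · exact ⟨z, by omega, hzy, hzy⟩
  obtain ⟨v, hv, hv'⟩ := hG.exists_common_adj hc (s := s) (i := i) (by omega) (by omega) hzy
    hzy' h.toWalk (by simp [hy, hy'])
  simp only [Adj.toWalk, Walk.support_cons, Walk.support_nil, List.mem_cons, List.not_mem_nil,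
    or_false] at hv
  rcases hv with rfl | rfl
  · exact ⟨z', by omega, hv'.2, hzy'⟩
  · exact ⟨z, by omega, hzy, hv'.1⟩

/-- A geodesic from `x` to a vertex not joined to `x` above layer `i` can be chosen to descend
directly to layer `i`. -/
lemma IsChordal.exists_mem_shadow_dist_le (hG : G.IsChordal) (hc : G.Connected) {i : ℕ} {x y : V}
    (hx : i ≤ G.dist s x) (h : ¬ G.JoinedAbove s (i + 1) x y) :
    ∃ p ∈ G.shadow s i x, G.dist s x + G.dist p y ≤ G.dist x y + i := by
  rcases hx.eq_or_lt with rfl | hx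
  · exact ⟨x, mem_shadow_self x, by omega⟩
  obtain ⟨w, hw⟩ := hc.exists_walk_length_eq_dist x y
  have h' : ∃ v ∈ w.support, G.dist s v ≤ i := by
    by_contra! h'
    exact h ⟨w, h'⟩
  obtain ⟨a, b, q, r, hq, hab, hb, hl⟩ := w.exists_first_edge (P := fun v => G.dist s v ≤ i)
    (by omega) h'
  simp only [not_le] at hq
  have ha : i < G.dist s a := hq a q.end_mem_support
  have hab' := hc.dist_le_succ_of_adj s hab
  have hbi : G.dist s b = i := by omega
  have hxb : G.dist x b ≤ q.length + 1 := by
    have := G.dist_le (q.append hab.toWalk)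
    simpa using this
  have hby := G.dist_le r
  have hsx := hc.dist_triangle (u := s) (v := b) (w := x)
  rw [dist_comm (u := b)] at hsx
  by_cases hbx : G.dist s x = i + G.dist x b
  · exact ⟨b, ⟨hbi, by rw [dist_comm (u := b)]; omega⟩, by omega⟩
  · obtain ⟨p, hp⟩ := shadow_nonempty hc (x := x) hx.le
    obtain ⟨p', hp', hpp'⟩ := exists_adj_of_mem_shadow hc hp hx
    have h1 := hG.eq_or_adj_of_joinedAbove hc hp.1 hbi hpp' hab.symm
      ((joinedAbove_of_mem_shadow hc hx hp').trans ⟨q, hq⟩)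
    rw [hc.eq_or_adj_iff] at h1
    have h2 := hc.dist_triangle (u := p) (v := b) (w := y)
    exact ⟨p, hp, by omega⟩

/-- If `x` and `y` are not joined above layer `i`, then some geodesic between them descends directly
to layer `i` from both ends. -/
lemma IsChordal.exists_mem_shadow_mem_shadow (hG : G.IsChordal) (hc : G.Connected) {i : ℕ}
    {x y : V} (hx : i ≤ G.dist s x) (hy : i ≤ G.dist s y) (h : ¬ G.JoinedAbove s (i + 1) x y) :
    ∃ p ∈ G.shadow s i x, ∃ q ∈ G.shadow s i y,
      G.dist s x + G.dist s y + G.dist p q ≤ G.dist x y + 2 * i := by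
  obtain ⟨p, hp, hxy⟩ := hG.exists_mem_shadow_dist_le hc hx h
  obtain ⟨q, hq, hyp⟩ := hG.exists_mem_shadow_dist_le hc (y := p) hy (fun h' => by
    have := h'.right_le
    have := hp.1
    omega)
  rw [dist_comm (u := q), dist_comm (u := y)] at hyp
  exact ⟨p, hp, q, hq, by omega⟩

lemma dist_le_of_mem_shadow (hc : G.Connected) {i : ℕ} {x y p q : V} (hp : p ∈ G.shadow s i x)
    (hq : q ∈ G.shadow s i y) :
    G.dist x y + 2 * i ≤ G.dist s x + G.dist s y + G.dist p q := by
  have h1 := hc.dist_triangle (u := x) (v := p) (w := y)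
  have h2 := hc.dist_triangle (u := p) (v := q) (w := y)
  have h3 := hp.2
  have h4 := hq.2
  rw [dist_comm (u := x) (v := p)] at h1
  omega

end Layers

end SimpleGraph

namespace SimpleGraph

section LexOrdering

variable {V : Type*} {G : SimpleGraph V} {s : V} {τ : V → ℕ}

/-- The order in which LexBFS started in `s` visits the vertices, where `τ v` is the time at which
`v` is visited: a vertex visited before a competitor with a private visited neighbour has
itself an even earlier private neighbour. -/
structure IsLexOrdering (G : SimpleGraph V) (s : V) (τ : V → ℕ) : Prop where
  injective : Function.Injective τ
  first_le : ∀ v, τ s ≤ τ v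
  exists_private : ∀ a b c, τ a < τ b → τ b < τ c → G.Adj a c → ¬ G.Adj a b →
    ∃ d, τ d < τ a ∧ G.Adj d b ∧ ¬ G.Adj d c

/-- `x` and `y` are joined by a walk inside `S`. -/
def JoinedIn (G : SimpleGraph V) (S : Set V) (x y : V) : Prop :=
  ∃ w : G.Walk x y, ∀ v ∈ w.support, v ∈ S

lemma JoinedIn.step {S : Set V} {x y z : V} (hxy : x = y ∨ G.Adj x y) (hx : x ∈ S)
    (h : G.JoinedIn S y z) : G.JoinedIn S x z := by
  rcases hxy with rfl | hxy
  · exact h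
  obtain ⟨w, hw⟩ := h
  refine ⟨Walk.cons hxy w, fun v hv => ?_⟩
  simp only [Walk.support_cons, List.mem_cons] at hv
  rcases hv with rfl | hv
  · exact hx
  · exact hw v hv

lemma JoinedIn.refl {S : Set V} {x : V} (hx : x ∈ S) : G.JoinedIn S x x :=
  ⟨Walk.nil, by simpa using hx⟩

lemma IsChordal.exists_common_adj_of_joinedIn (hG : G.IsChordal) (hc : G.Connected) {i : ℕ}
    {S : Set V} {y y' z z' : V} (hz : G.dist s z = i) (hz' : G.dist s z' = i) (hzy : G.Adj z y)
    (hzy' : G.Adj z' y') (h : G.JoinedIn S y y') (hS : ∀ v ∈ S, i + 1 ≤ G.dist s v) :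
    ∃ v ∈ S, G.Adj z v ∧ G.Adj z' v := by
  obtain ⟨w, hw⟩ := h
  obtain ⟨v, hv, hv'⟩ := hG.exists_common_adj hc hz hz' hzy hzy' w (fun v hv => hS v (hw v hv))
  exact ⟨v, hw v hv, hv'⟩

lemma exists_earliest (τ : V → ℕ) {S : Set V} (hS : S.Nonempty) :
    ∃ g ∈ S, ∀ p ∈ S, τ g ≤ τ p := by
  obtain ⟨g, hg, h⟩ := Nat.sInf_mem (hS.image τ)
  exact ⟨g, hg, fun p hp => h ▸ Nat.sInf_le (Set.mem_image_of_mem τ hp)⟩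

namespace IsLexOrdering

variable (h : G.IsLexOrdering s τ) (hc : G.Connected)
include h

lemma lt_of_le_of_ne {x y : V} (hxy : τ x ≤ τ y) (hne : x ≠ y) : τ x < τ y :=
  Nat.lt_of_le_of_ne hxy (fun e => hne (h.injective e))

include hc

lemma exists_earlier_adj {x : V} (hx : x ≠ s) : ∃ a, G.Adj a x ∧ τ a < τ x := by
  obtain ⟨w⟩ := hc.preconnected s x
  obtain ⟨a, b, q, r, hq, hab, hb, -⟩ := w.exists_first_edge (P := fun v => τ x ≤ τ v)
    (not_le.2 (h.lt_of_le_of_ne (h.first_le x) hx.symm)) ⟨x, w.end_mem_support, le_rfl⟩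
  have ha : τ a < τ x := not_le.1 (hq a q.end_mem_support)
  by_cases hax : G.Adj a x
  · exact ⟨a, hax, ha⟩
  · have hxb : x ≠ b := by rintro rfl; exact hax hab
    obtain ⟨d, hd, hdx, -⟩ := h.exists_private a x b ha (h.lt_of_le_of_ne hb hxb) hab hax
    exact ⟨d, hdx, hd.trans ha⟩

lemma exists_adj_le {a x y : V} (hxy : τ x ≤ τ y) (hx : x ≠ s) (ha : G.Adj a y) :
    ∃ d, G.Adj d x ∧ τ d ≤ τ a := by
  by_cases hax : G.Adj a x
  · exact ⟨a, hax, le_rfl⟩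
  have hne : x ≠ y := by rintro rfl; exact hax ha
  rcases le_or_gt (τ x) (τ a) with h1 | h1
  · obtain ⟨d, hd, hd'⟩ := h.exists_earlier_adj hc hx
    exact ⟨d, hd, by omega⟩
  · obtain ⟨d, hd, hdx, -⟩ := h.exists_private a x y h1 (h.lt_of_le_of_ne hxy hne) ha hax
    exact ⟨d, hdx, hd.le⟩

lemma lt_of_dist_lt {z y : V} (hzy : G.dist s z < G.dist s y) : τ z < τ y := by
  have key : ∀ L z y, G.dist s z ≤ L → L < G.dist s y → τ z < τ y := by
    intro L
    induction L with
    | zero =>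
      intro z y hz hy
      obtain rfl := hc.dist_eq_zero_iff.1 (Nat.le_zero.1 hz)
      refine h.lt_of_le_of_ne (h.first_le y) ?_
      rintro rfl
      simp at hy
    | succ L ih =>
      intro z y hz hy
      by_contra! hlt
      have hys : y ≠ s := by rintro rfl; simp at hy
      rcases Nat.lt_or_ge (G.dist s z) (L + 1) with h1 | h1
      · have := ih z y (by omega) (by omega)
        omega
      obtain ⟨a, haz, ha⟩ := hc.exists_adj_dist_pred (s := s) (z := z) (by omega)
      obtain ⟨d, hdy, hd⟩ := h.exists_adj_le hc hlt hys haz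
      have h2 := hc.dist_le_succ_of_adj s hdy.symm
      have := ih a d (by omega) (by omega)
      omega
  exact key _ z y le_rfl hzy

lemma dist_le_of_le {z y : V} (hzy : τ z ≤ τ y) : G.dist s z ≤ G.dist s y := by
  by_contra! hlt
  have := h.lt_of_dist_lt hc hlt
  omega

lemma exists_lower_private {i : ℕ} {y y' z : V} (hy : G.dist s y = i + 1)
    (hyy' : τ y ≤ τ y') (hz : G.dist s z = i) (hzy' : G.Adj z y')
    (hzy : ¬ G.Adj z y) : ∃ d, G.dist s d = i ∧ G.Adj d y ∧ ¬ G.Adj d y' := by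
  have hne : y ≠ y' := by rintro rfl; exact hzy hzy'
  obtain ⟨d, hd, hdy, hdy'⟩ := h.exists_private z y y' (h.lt_of_dist_lt hc (by omega))
    (h.lt_of_le_of_ne hyy' hne) hzy' hzy
  refine ⟨d, ?_, hdy, hdy'⟩
  have h1 := h.dist_le_of_le hc hd.le
  have h2 := hc.dist_le_succ_of_adj s hdy.symm
  omega

lemma exists_mem_shadow_le {i : ℕ} {x y p : V} (hxy : τ x ≤ τ y) (hd : G.dist s x = G.dist s y)
    (hi : i ≤ G.dist s x) (hp : p ∈ G.shadow s i y) : ∃ q ∈ G.shadow s i x, τ q ≤ τ p := by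
  induction hi using Nat.decreasingInduction generalizing p with
  | self =>
    rw [hd] at hp
    rw [mem_shadow_dist_eq hc hp]
    exact ⟨x, mem_shadow_self x, hxy⟩
  | of_succ i hi ih =>
    obtain ⟨p', hp', hpp'⟩ := exists_adj_of_mem_shadow hc hp (by omega)
    obtain ⟨q', hq', hqp'⟩ := ih hp'
    have hq's : q' ≠ s := by
      rintro rfl
      have := hq'.1
      simp at this
    obtain ⟨d, hdq, hdp⟩ := h.exists_adj_le hc hqp' hq's hpp'
    refine ⟨d, mem_shadow_of_adj hc hq' hdq ?_, hdp⟩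
    have h1 := h.dist_le_of_le hc hdp
    have h2 := hc.dist_le_succ_of_adj s hdq.symm
    have h3 := hp.1
    have h4 := hq'.1
    omega

variable (hG : G.IsChordal)
include hG

lemma exists_earliest_mem_shadow {i : ℕ} {x : V} (hi : i + 1 ≤ G.dist s x) :
    ∃ g ∈ G.shadow s (i + 1) x, (∀ p ∈ G.shadow s (i + 1) x, τ g ≤ τ p) ∧
      ∀ z ∈ G.shadow s i x, G.Adj z g := by
  obtain ⟨g, hg, hmin⟩ := exists_earliest τ (shadow_nonempty hc hi)
  refine ⟨g, hg, hmin, fun z hz => ?_⟩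
  by_contra hzg
  obtain ⟨p, hp, hzp⟩ := exists_adj_of_mem_shadow hc hz hi
  obtain ⟨d, hd, hdg, hdp⟩ := h.exists_lower_private hc hg.1 (hmin p hp) hz.1 hzp hzg
  obtain ⟨v, hv, hv'⟩ := hG.exists_common_adj_of_joinedIn hc (S := {p, g}) hz.1 hd hzp hdg
    (JoinedIn.step (hG.eq_or_adj_of_mem_shadow_self hc hi hp hg) (by simp)
      (JoinedIn.refl (by simp)))
    (by rintro v (rfl | rfl); exacts [hp.1.ge, hg.1.ge])
  rcases hv with rfl | rfl
  · exact hdp hv'.2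
  · exact hzg hv'.1

lemma shadow_subset {j : ℕ} {a u : V} (hau : τ a ≤ τ u) (hd : G.dist s a = G.dist s u)
    (hj : j + 1 ≤ G.dist s u) (ht : G.Touch (G.shadow s (j + 1) u) (G.shadow s (j + 1) a)) :
    G.shadow s j u ⊆ G.shadow s j a := by
  obtain ⟨g, hg, hgmin, hgadj⟩ := h.exists_earliest_mem_shadow hc hG hj
  obtain ⟨r, hr, hrmin, hradj⟩ := h.exists_earliest_mem_shadow hc hG (hd ▸ hj : j + 1 ≤ G.dist s a)
  obtain ⟨p, hp, q, hq, hpq⟩ := ht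
  obtain ⟨r', hr', hrg'⟩ := h.exists_mem_shadow_le hc hau hd (by omega) hg
  have hrg : τ r ≤ τ g := (hrmin r' hr').trans hrg'
  have hna : ∀ {z q}, G.dist s z = j → z ∉ G.shadow s j a → q ∈ G.shadow s (j + 1) a →
      ¬ G.Adj z q := fun hz hza hq hzq => hza (mem_shadow_of_adj hc hq hzq hz)
  intro z hz
  by_contra hza
  obtain ⟨d, hd', hdr, hdg⟩ := h.exists_lower_private hc hr.1 hrg hz.1 (hgadj z hz)
    (hna hz.1 hza hr)
  obtain ⟨v, hv, hzv, hdv⟩ := hG.exists_common_adj_of_joinedIn hc (S := {g, p, q, r}) hz.1 hd'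
    (hgadj z hz) hdr
    (JoinedIn.step (hG.eq_or_adj_of_mem_shadow_self hc hj hg hp) (by simp)
      (JoinedIn.step hpq (by simp)
        (JoinedIn.step (hG.eq_or_adj_of_mem_shadow_self hc (by omega) hq hr) (by simp)
      (JoinedIn.refl (by simp)))))
    (by rintro v (rfl | rfl | rfl | rfl); exacts [hg.1.ge, hp.1.ge, hq.1.ge, hr.1.ge])
  rcases hv with rfl | rfl | rfl | rfl
  · exact hdg hdv
  · exact hdg (hgadj d (mem_shadow_of_adj hc hp hdv hd'))
  · exact hna hz.1 hza hq hzv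
  · exact hna hz.1 hza hr hzv

omit hc in
/-- A LexBFS ordering of a chordal graph, reversed, is a perfect elimination ordering. -/
lemma eq_or_adj_of_joinedIn {t r : V} (htr : τ t ≤ τ r)
    (hw : G.JoinedIn {v | v = t ∨ τ r ≤ τ v} t r) : t = r ∨ G.Adj t r := by
  induction hn : τ r using Nat.strong_induction_on generalizing t r with
  | _ n ih =>
  subst hn
  by_contra! hne
  have htr' := h.lt_of_le_of_ne htr hne.1
  obtain ⟨w, hw⟩ := hw
  obtain ⟨q, hqp, hq, hqc⟩ := w.exists_chordless hw
  cases q with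
  | nil => exact hne.1 rfl
  | @cons _ x _ htx q =>
  rw [Walk.cons_isPath_iff] at hqp
  have hq' : ∀ v ∈ q.support, τ r ≤ τ v := fun v hv =>
    (hq v (by simp [hv])).resolve_left (fun e => hqp.2 (e ▸ hv))
  have hxr : r ≠ x := fun e => hne.2 (e ▸ htx)
  obtain ⟨d, hdt, hdr, hdx⟩ := h.exists_private t r x htr'
    (h.lt_of_le_of_ne (hq' x q.start_mem_support) hxr) htx hne.2
  have hdt' : G.Adj d t := by
    refine (ih (τ t) htr' hdt.le ⟨Walk.cons hdr (Walk.cons htx q).reverse, fun v hv => ?_⟩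
      rfl).resolve_left (fun e => by subst e; omega)
    simp only [Walk.support_cons, Walk.support_reverse, List.mem_cons, List.mem_reverse] at hv
    rcases hv with rfl | rfl | hv
    · exact Or.inl rfl
    · exact Or.inr le_rfl
    · exact Or.inr (htr.trans (hq' v hv))
  obtain ⟨v, q₁, hdv, hq₁, hq₁'⟩ := q.exists_first (P := fun v => G.Adj d v) hdr
  have hvq := hq₁ v q₁.end_mem_support
  have htv : G.Adj t v := by
    refine hG.adj_of_walks (fun e => hqp.2 (e ▸ hvq)) (A := {u | ¬ G.Adj d u ∧ u ≠ d})
      (B := {d}) (Walk.cons htx q₁) ?_ (Walk.cons hdt'.symm (Walk.cons hdv Walk.nil)) ?_ ?_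
    · intro u hu
      simp only [Walk.support_cons, List.mem_cons] at hu
      rcases hu with rfl | hu
      · simp
      · by_cases huv : u = v
        · simp [huv]
        · refine Or.inr (Or.inr ⟨hq₁' u hu huv, ?_⟩)
          rintro rfl
          have := hq' _ (hq₁ _ hu)
          omega
    · intro u hu
      simp at hu
      simp only [Set.mem_singleton_iff]
      tauto
    · rintro a ⟨ha, ha'⟩ b rfl
      exact ⟨ha', fun h => ha h.symm⟩
  have hmem := hqc t (by simp) v (by simp [hvq]) htv
  rw [Walk.edges_cons, List.mem_cons] at hmem
  rcases hmem with hmem | hmem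
  · have hvx : v = x := by
      have h1 : v = x ∨ t = x ∧ v = t := by simpa using hmem
      exact h1.resolve_right (fun h2 => htx.ne h2.1)
    exact hdx (hvx ▸ hdv)
  · exact hqp.2 (Walk.fst_mem_support_of_mem_edges q hmem)

lemma touch_trans {i : ℕ} {a b u : V} (hau : τ a ≤ τ u) (hbu : τ b ≤ τ u)
    (hda : G.dist s a = G.dist s u) (hdb : G.dist s b = G.dist s u) (hi : i ≤ G.dist s u)
    (ha : G.Touch (G.shadow s i u) (G.shadow s i a))
    (hb : G.Touch (G.shadow s i u) (G.shadow s i b)) :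
    G.Touch (G.shadow s i a) (G.shadow s i b) := by
  obtain ⟨ra, hra, hramin⟩ := exists_earliest τ (shadow_nonempty hc (hda ▸ hi : i ≤ G.dist s a))
  obtain ⟨rb, hrb, hrbmin⟩ := exists_earliest τ (shadow_nonempty hc (hdb ▸ hi : i ≤ G.dist s b))
  wlog hab : τ ra ≤ τ rb generalizing a b ra rb
  · exact (this hbu hau hdb hda hb ha rb hrb hrbmin ra hra hramin (by omega)).symm
  have hu : ∀ p ∈ G.shadow s i u, τ rb ≤ τ p := by
    intro p hp
    obtain ⟨q, hq, hqp⟩ := h.exists_mem_shadow_le hc hbu hdb (by omega) hp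
    exact (hrbmin q hq).trans hqp
  obtain ⟨pa, hpa, qa, hqa, hpqa⟩ := ha
  obtain ⟨pb, hpb, qb, hqb, hpqb⟩ := hb
  have h1 : ∀ t, G.JoinedIn {v | v = t ∨ τ rb ≤ τ v} pa rb := fun t =>
    JoinedIn.step (hG.eq_or_adj_of_mem_shadow_self hc hi hpa hpb) (Or.inr (hu _ hpa))
      (JoinedIn.step hpqb (Or.inr (hu _ hpb))
        (JoinedIn.step (hG.eq_or_adj_of_mem_shadow_self hc (by omega) hqb hrb)
          (Or.inr (hrbmin _ hqb)) (JoinedIn.refl (Or.inr le_rfl))))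
  rcases le_or_gt (τ rb) (τ qa) with hq | hq
  · exact ⟨ra, hra, rb, hrb, h.eq_or_adj_of_joinedIn hG hab
      (JoinedIn.step (hG.eq_or_adj_of_mem_shadow_self hc (by omega) hra hqa) (Or.inl rfl)
        (JoinedIn.step (hpqa.imp Eq.symm Adj.symm) (Or.inr hq) (h1 ra)))⟩
  · exact ⟨qa, hqa, rb, hrb, h.eq_or_adj_of_joinedIn hG hq.le
      (JoinedIn.step (hpqa.imp Eq.symm Adj.symm) (Or.inl rfl) (h1 qa))⟩

lemma exists_dist_le_two {i : ℕ} {a b u p q : V} (hau : τ a ≤ τ u)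
    (hda : G.dist s a = G.dist s u) (hi : i ≤ G.dist s u) (hib : i ≤ G.dist s b)
    (ha : G.Touch (G.shadow s i u) (G.shadow s i a)) (hp : p ∈ G.shadow s i u)
    (hq : q ∈ G.shadow s i b) (hpq : G.dist p q ≤ 2) :
    ∃ x ∈ G.shadow s i a, ∃ y ∈ G.shadow s i b, G.dist x y ≤ 2 := by
  by_contra! hcon
  obtain _ | i := i
  · obtain ⟨x, hx⟩ := shadow_nonempty hc (s := s) (i := 0) (x := a) (by omega)
    have h1 := hc.dist_eq_zero_iff.1 hx.1
    have h2 := hc.dist_eq_zero_iff.1 hq.1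
    have := hcon x hx q hq
    rw [← h1, ← h2, dist_self] at this
    omega
  have hdisj : ∀ z, z ∈ G.shadow s i a → z ∉ G.shadow s i b := by
    intro z hza hzb
    obtain ⟨x, hx, hzx⟩ := exists_adj_of_mem_shadow hc hza (by omega)
    obtain ⟨y, hy, hzy⟩ := exists_adj_of_mem_shadow hc hzb (by omega)
    have h1 := hcon x hx y hy
    have h2 := G.dist_le (Walk.cons hzx.symm (Walk.cons hzy Walk.nil))
    simp at h2
    omega
  have hsub := h.shadow_subset hc hG hau hda hi ha
  have hab : ∀ {z v}, G.dist s z = i → z ∉ G.shadow s i a →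
      v ∈ G.shadow s (i + 1) u ∨ v ∈ G.shadow s (i + 1) a → ¬ G.Adj z v := by
    rintro z v hz hza (hv | hv) hzv
    · exact hza (hsub (mem_shadow_of_adj hc hv hzv hz))
    · exact hza (mem_shadow_of_adj hc hv hzv hz)
  have hpq1 : ¬ (p = q ∨ G.Adj p q) := by
    intro hpq
    obtain ⟨z, hz, hzp, hzq⟩ := hG.exists_common_lower hc hp.1 hq.1 hpq
    exact hdisj z (hsub (mem_shadow_of_adj hc hp hzp hz)) (mem_shadow_of_adj hc hq hzq hz)
  rw [hc.eq_or_adj_iff] at hpq1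
  obtain ⟨w, hw⟩ := hc.exists_walk_length_eq_dist p q
  obtain ⟨m, hpm, hmq⟩ : ∃ m, G.Adj p m ∧ G.Adj m q := by
    match w, hw with
    | .cons h₁ (.cons h₂ .nil), _ => exact ⟨_, h₁, h₂⟩
    | .nil, hw => simp only [Walk.length_nil] at hw; omega
    | .cons _ .nil, hw => simp only [Walk.length_cons, Walk.length_nil] at hw; omega
    | .cons _ (.cons _ (.cons _ _)), hw => simp only [Walk.length_cons] at hw; omega
  have hm1 := hc.dist_le_succ_of_adj s hpm
  have hm2 := hc.dist_le_succ_of_adj s hpm.symm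
  rw [hp.1] at hm1 hm2
  have hm : G.dist s m = i + 1 := by
    rcases lt_trichotomy (G.dist s m) (i + 1) with hlt | heq | hgt
    · have hmi : G.dist s m = i := by omega
      exact absurd (mem_shadow_of_adj hc hq hmq hmi)
        (hdisj m (hsub (mem_shadow_of_adj hc hp hpm.symm hmi)))
    · exact heq
    · exfalso
      refine hpq1 (hc.eq_or_adj_iff.1 (hG.eq_or_adj_of_joinedAbove hc hp.1 hq.1 hpm hmq.symm
        (JoinedAbove.refl (by omega))))
  obtain ⟨r, hr, hrmin, hradj⟩ := h.exists_earliest_mem_shadow hc hG (hda ▸ hi : i + 1 ≤ G.dist s a)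
  obtain ⟨pa, hpa, qa, hqa, hpqa⟩ := ha
  have hu : ∀ p ∈ G.shadow s (i + 1) u, τ r ≤ τ p := by
    intro p hp
    obtain ⟨q, hq, hqp⟩ := h.exists_mem_shadow_le hc hau hda (by omega) hp
    exact (hrmin q hq).trans hqp
  have hrqa := hG.eq_or_adj_of_mem_shadow_self hc (by omega) hr hqa
  have hpapp := hG.eq_or_adj_of_mem_shadow_self hc hi hpa hp
  obtain ⟨z', hz', hz'm, hz'q⟩ := hG.exists_common_lower hc hm hq.1 (Or.inr hmq)
  have hz'a : z' ∉ G.shadow s i a := fun hza => hdisj z' hza (mem_shadow_of_adj hc hq hz'q hz')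
  have hrm : ∀ z, G.dist s z = i → G.Adj z r → G.Adj z m := by
    intro z hz hzr
    obtain ⟨v, hv, hzv, hz'v⟩ := hG.exists_common_adj_of_joinedIn hc (S := {r, qa, pa, p, m}) hz
      hz' hzr hz'm
      (JoinedIn.step hrqa (by simp) (JoinedIn.step (hpqa.imp Eq.symm Adj.symm) (by simp)
        (JoinedIn.step hpapp (by simp) (JoinedIn.step (Or.inr hpm) (by simp)
          (JoinedIn.refl (by simp))))))
      (by
        rintro v (rfl | rfl | rfl | rfl | rfl)
        exacts [hr.1.ge, hqa.1.ge, hpa.1.ge, hp.1.ge, hm.ge])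
    rcases hv with rfl | rfl | rfl | rfl | rfl
    · exact absurd hz'v (hab hz' hz'a (Or.inr hr))
    · exact absurd hz'v (hab hz' hz'a (Or.inr hqa))
    · exact absurd hz'v (hab hz' hz'a (Or.inl hpa))
    · exact absurd hz'v (hab hz' hz'a (Or.inl hp))
    · exact hzv
  have hmr : τ m ≤ τ r := by
    by_contra! hlt
    obtain ⟨d, hd, hdr, hdm⟩ := h.exists_lower_private hc hr.1 hlt.le hz' hz'm
      (hab hz' hz'a (Or.inr hr))
    exact hdm (hrm d hd hdr)
  have hfin : m = r ∨ G.Adj m r := h.eq_or_adj_of_joinedIn hG hmr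
    (JoinedIn.step (Or.inr hpm.symm) (Or.inl rfl)
      (JoinedIn.step (hpapp.imp Eq.symm Adj.symm) (Or.inr (hu _ hp))
        (JoinedIn.step hpqa (Or.inr (hu _ hpa))
          (JoinedIn.step (hrqa.imp Eq.symm Adj.symm) (Or.inr (hrmin _ hqa))
            (JoinedIn.refl (Or.inr le_rfl))))))
  rw [hc.eq_or_adj_iff, dist_comm] at hfin
  have h1 := hcon r hr q hq
  have h2 := hc.dist_triangle (u := r) (v := m) (w := q)
  have h3 := dist_eq_one_iff_adj.2 hmq
  omega

end IsLexOrdering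

end LexOrdering

end SimpleGraph

namespace SimpleGraph

section OddPowers

variable {V : Type*} {G : SimpleGraph V} {s : V} {τ : V → ℕ}

lemma touch_of_dist_le_one (hc : G.Connected) {A B : Set V} {a b : V} (ha : a ∈ A) (hb : b ∈ B)
    (h : G.dist a b ≤ 1) : G.Touch A B :=
  ⟨a, ha, b, hb, hc.eq_or_adj_iff.2 h⟩

lemma Touch.dist_le (hc : G.Connected) {i : ℕ} {x y : V}
    (h : G.Touch (G.shadow s i x) (G.shadow s i y)) :
    G.dist x y + 2 * i ≤ G.dist s x + G.dist s y + 1 := by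
  obtain ⟨p, hp, q, hq, hpq⟩ := h
  have h1 := dist_le_of_mem_shadow hc hp hq
  have h2 := hc.eq_or_adj_iff.1 hpq
  omega

lemma IsChordal.dist_le_of_joinedAbove (hG : G.IsChordal) (hc : G.Connected) {i : ℕ} {x y : V}
    (h : G.JoinedAbove s i x y) : G.dist x y + 2 * i ≤ G.dist s x + G.dist s y + 3 := by
  obtain _ | i := i
  · have := hc.dist_triangle (u := x) (v := s) (w := y)
    rw [dist_comm (u := x) (v := s)] at this
    omega
  · obtain ⟨p, hp⟩ := shadow_nonempty hc (s := s) (i := i) (x := x) (by have := h.left_le; omega)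
    obtain ⟨q, hq⟩ := shadow_nonempty hc (s := s) (i := i) (x := y) (by have := h.right_le; omega)
    have h1 := hc.eq_or_adj_iff.1 (hG.eq_or_adj_of_mem_shadow hc h hp hq)
    have h2 := dist_le_of_mem_shadow hc hp hq
    omega

namespace IsLexOrdering

variable (h : G.IsLexOrdering s τ) (hc : G.Connected) (hG : G.IsChordal)
include h hc hG

lemma dist_le_add_two {i : ℕ} {a b u p q : V} (hau : τ a ≤ τ u)
    (hda : G.dist s a = G.dist s u) (hi : i ≤ G.dist s u) (hib : i ≤ G.dist s b)
    (ha : G.Touch (G.shadow s i u) (G.shadow s i a)) (hp : p ∈ G.shadow s i u)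
    (hq : q ∈ G.shadow s i b) (hpq : G.dist p q ≤ 2) :
    G.dist a b + 2 * i ≤ G.dist s a + G.dist s b + 2 := by
  obtain ⟨x, hx, y, hy, hxy⟩ := h.exists_dist_le_two hc hG hau hda hi hib ha hp hq hpq
  have := dist_le_of_mem_shadow hc hx hy
  omega

lemma dist_le_odd_of_joinedAbove {k i : ℕ} {a b u : V} (hau : τ a ≤ τ u) (hbu : τ b ≤ τ u)
    (ha : G.dist u a ≤ 2 * k + 1) (hb : G.dist u b ≤ 2 * k + 1) (hib : G.JoinedAbove s i a b)
    (hua : G.JoinedAbove s (i + 1) u a) (hub : ¬ G.JoinedAbove s (i + 1) u b) :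
    G.dist a b ≤ 2 * k + 1 := by
  by_contra! hcon
  have hla := h.dist_le_of_le hc hau
  have hlb := h.dist_le_of_le hc hbu
  have hiu := hua.left_le
  have hia := hua.right_le
  have hibb := hib.right_le
  have hab3 := hG.dist_le_of_joinedAbove hc hib
  obtain ⟨p, hp, q, hq, hpq⟩ := hG.exists_mem_shadow_mem_shadow hc (by omega) hibb hub
  obtain ⟨x, hx⟩ := shadow_nonempty hc (s := s) (i := i) (x := a) (by omega)
  have hpx := hG.eq_or_adj_of_mem_shadow hc hua hp hx
  have h1 := hc.eq_or_adj_iff.1 hpx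
  have h2 := hc.dist_triangle (u := x) (v := p) (w := q)
  have h3 := dist_le_of_mem_shadow hc hx hq
  rw [dist_comm (u := x) (v := p)] at h2
  have hda : G.dist s a = G.dist s u := by omega
  have hnt : ¬ G.Touch (G.shadow s (i + 1) u) (G.shadow s (i + 1) a) := by
    intro ht
    have := dist_le_of_mem_shadow hc (h.shadow_subset hc hG hau hda hiu ht hp) hq
    omega
  have hdua : 2 * G.dist s u ≤ G.dist u a + 2 * i := by
    by_contra! hlt
    apply hnt
    by_cases hua' : G.JoinedAbove s (i + 1 + 1) u a
    · obtain ⟨y, hy⟩ := shadow_nonempty hc hiu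
      obtain ⟨z, hz⟩ := shadow_nonempty hc hia
      exact ⟨y, hy, z, hz, hG.eq_or_adj_of_mem_shadow hc hua' hy hz⟩
    · obtain ⟨y, hy, z, hz, hyz⟩ := hG.exists_mem_shadow_mem_shadow hc hiu hia hua'
      exact touch_of_dist_le_one hc hy hz (by omega)
  have htua : G.Touch (G.shadow s i u) (G.shadow s i a) := ⟨p, hp, x, hx, hpx⟩
  by_cases hcase : G.dist s b = G.dist s u ∧ G.dist p q ≤ 1
  · have := (h.touch_trans hc hG hau hbu hda hcase.1 (by omega) htua
      (touch_of_dist_le_one hc hp hq hcase.2)).dist_le hc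
    omega
  · by_cases hpq2 : G.dist p q ≤ 2
    · have := h.dist_le_add_two hc hG hau hda (by omega) hibb htua hp hq hpq2
      omega
    · omega

/-- The last vertex of a LexBFS ordering of a chordal graph is simplicial in all odd powers. -/
theorem dist_le_odd {k : ℕ} {a b u : V} (hau : τ a ≤ τ u) (hbu : τ b ≤ τ u)
    (ha : G.dist u a ≤ 2 * k + 1) (hb : G.dist u b ≤ 2 * k + 1) :
    G.dist a b ≤ 2 * k + 1 := by
  have hjoin : ∀ x y, G.JoinedAbove s 0 x y := fun x y =>
    ⟨(hc.preconnected x y).some, by simp⟩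
  obtain ⟨i, hi, hi'⟩ : ∃ i, G.JoinedAbove s i a b ∧ ¬ G.JoinedAbove s (i + 1) a b := by
    by_contra! hall
    have : ∀ i, G.JoinedAbove s i a b := fun i => Nat.rec (hjoin a b) hall i
    have := (this (G.dist s a + 1)).left_le
    omega
  by_contra! hcon
  have hla := h.dist_le_of_le hc hau
  have hlb := h.dist_le_of_le hc hbu
  have hia := hi.left_le
  have hib := hi.right_le
  have hab3 := hG.dist_le_of_joinedAbove hc hi
  by_cases hua : G.JoinedAbove s i u a
  · by_cases hua' : G.JoinedAbove s (i + 1) u a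
    · have := h.dist_le_odd_of_joinedAbove hc hG hau hbu ha hb hi hua'
        (fun hub => hi' (hua'.symm.trans hub))
      omega
    by_cases hub' : G.JoinedAbove s (i + 1) u b
    · have := h.dist_le_odd_of_joinedAbove hc hG hbu hau hb ha hi.symm hub' hua'
      rw [dist_comm] at this
      omega
    obtain ⟨p, hp, p', hp', hpp⟩ := hG.exists_mem_shadow_mem_shadow hc hua.left_le hia hua'
    obtain ⟨q, hq, q', hq', hqq⟩ := hG.exists_mem_shadow_mem_shadow hc hua.left_le hib hub'
    have h1 := hc.eq_or_adj_iff.1 (hG.eq_or_adj_of_mem_shadow_self hc hua.left_le hp hq)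
    have h2 := hc.dist_triangle (u := p') (v := p) (w := q')
    have h3 := hc.dist_triangle (u := p) (v := q) (w := q')
    have h4 := dist_le_of_mem_shadow hc hp' hq'
    rw [dist_comm (u := p') (v := p)] at h2
    have hT : G.dist s a = G.dist s u → G.dist s b = G.dist s u → G.dist p p' ≤ 1 →
        G.dist q q' ≤ 1 → G.dist a b + 2 * i ≤ G.dist s a + G.dist s b + 1 :=
      fun e1 e2 e3 e4 => (h.touch_trans hc hG hau hbu e1 e2 hua.left_le
        (touch_of_dist_le_one hc hp hp' e3) (touch_of_dist_le_one hc hq hq' e4)).dist_le hc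
    have hTa : G.dist s a = G.dist s u → G.dist p p' ≤ 1 → G.dist q q' ≤ 2 →
        G.dist a b + 2 * i ≤ G.dist s a + G.dist s b + 2 :=
      fun e1 e2 e3 => h.dist_le_add_two hc hG hau e1 hua.left_le hib
        (touch_of_dist_le_one hc hp hp' e2) hq hq' e3
    have hTb : G.dist s b = G.dist s u → G.dist q q' ≤ 1 → G.dist p p' ≤ 2 →
        G.dist b a + 2 * i ≤ G.dist s b + G.dist s a + 2 :=
      fun e1 e2 e3 => h.dist_le_add_two hc hG hbu e1 hua.left_le hia
        (touch_of_dist_le_one hc hq hq' e2) hp hp' e3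
    rw [dist_comm (u := b)] at hTb
    omega
  · obtain _ | i := i
    · exact hua (hjoin u a)
    have hub : ¬ G.JoinedAbove s (i + 1) u b := fun hub => hua (hub.trans hi.symm)
    obtain ⟨p, -, p', -, hpp⟩ := hG.exists_mem_shadow_mem_shadow hc (s := s) (i := i) (x := u)
      (y := a) (by omega) (by omega) hua
    obtain ⟨q, -, q', -, hqq⟩ := hG.exists_mem_shadow_mem_shadow hc (s := s) (i := i) (x := u)
      (y := b) (by omega) (by omega) hub
    omega

end IsLexOrdering

end OddPowers

/-! ### Executions of LexBFS -/

section Executions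

variable {V : Type*} {G : SimpleGraph V}

open Classical in
/-- The part of a label contributed by the vertices visited at the times `m, m + 1, …`. -/
noncomputable def labelFrom (G : SimpleGraph V) (n m : ℕ) (l : List V) (y : V) : List ℕ :=
  (l.zipIdx m).filterMap fun p => if G.Adj p.1 y then some (n - p.2) else none

lemma labelFrom_cons_of_adj {n m : ℕ} {a y : V} {l : List V} (h : G.Adj a y) :
    G.labelFrom n m (a :: l) y = (n - m) :: G.labelFrom n (m + 1) l y := by
  simp [labelFrom, h]

lemma labelFrom_cons_of_not_adj {n m : ℕ} {a y : V} {l : List V} (h : ¬ G.Adj a y) :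
    G.labelFrom n m (a :: l) y = G.labelFrom n (m + 1) l y := by
  simp [labelFrom, h]

lemma labelFrom_lt {n m : ℕ} {l : List V} {y : V} (hn : m + l.length ≤ n) :
    ∀ x ∈ G.labelFrom n m l y, x + m ≤ n ∧ 0 < x := by
  induction l generalizing m with
  | nil => simp [labelFrom]
  | cons a l ih =>
    rw [List.length_cons] at hn
    intro x hx
    by_cases h : G.Adj a y
    · rw [labelFrom_cons_of_adj h, List.mem_cons] at hx
      rcases hx with rfl | hx
      · omega
      · have := ih (by omega) x hx
        omega
    · rw [labelFrom_cons_of_not_adj h] at hx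
      have := ih (by omega) x hx
      omega

lemma labelFrom_lt_labelFrom {n m : ℕ} {l : List V} {x y : V} (hn : m + l.length ≤ n)
    {t : ℕ} (ht : t < l.length) (hty : G.Adj l[t] y) (htx : ¬ G.Adj l[t] x)
    (hlt : ∀ (t' : ℕ) (h : t' < t), G.Adj l[t'] x → G.Adj l[t'] y) :
    G.labelFrom n m l x < G.labelFrom n m l y := by
  induction l generalizing m t with
  | nil => simp at ht
  | cons a l ih =>
    rw [List.length_cons] at hn ht
    by_cases hax : G.Adj a x
    · have hay : G.Adj a y := by
        rcases t with _ | t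
        · exact absurd hax htx
        · exact hlt 0 (by omega) hax
      rw [labelFrom_cons_of_adj hax, labelFrom_cons_of_adj hay]
      rcases t with _ | t
      · exact absurd hax htx
      refine List.Lex.cons (ih (by omega) (t := t) (by omega) hty htx fun t' h' ha => ?_)
      exact hlt (t' + 1) (by omega) ha
    · rw [labelFrom_cons_of_not_adj hax]
      by_cases hay : G.Adj a y
      · rw [labelFrom_cons_of_adj hay]
        have hall := labelFrom_lt (G := G) (n := n) (m := m + 1) (l := l) (y := x) (by omega)
        cases hL : G.labelFrom n (m + 1) l x with
        | nil => exact List.Lex.nil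
        | cons b L =>
          refine List.Lex.rel ?_
          have := hall b (by simp [hL])
          omega
      · rw [labelFrom_cons_of_not_adj hay]
        rcases t with _ | t
        · exact absurd hty hay
        exact ih (by omega) (t := t) (by omega) hty htx fun t' h' ha => hlt (t' + 1) (by omega) ha

variable [Fintype V]

lemma LexBFSLast.exists_isLexOrdering {s u : V} (h : G.LexBFSLast s u) :
    ∃ τ : V → ℕ, G.IsLexOrdering s τ ∧ ∀ v, τ v ≤ τ u := by
  classical
  obtain ⟨ord, ⟨hnd, hmem, hhead, hlab⟩, hlast⟩ := h
  have hcard : ord.length ≤ Fintype.card V := hnd.length_le_card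
  have hlt : ∀ v, ord.idxOf v < ord.length := fun v => List.idxOf_lt_length_iff.2 (hmem v)
  have hget : ∀ v, ord[ord.idxOf v]'(hlt v) = v := fun v => List.getElem_idxOf (hlt v)
  refine ⟨fun v => ord.idxOf v, ⟨?_, ?_, ?_⟩, ?_⟩
  · intro x y hxy
    exact (List.idxOf_inj (hmem x)).1 hxy
  · intro v
    cases ord with
    | nil => simp at hhead
    | cons a l =>
      simp only [List.head?_cons, Option.some.injEq] at hhead
      subst hhead
      simp
  · intro a b c hab hbc hac hnab
    by_contra! hcon
    have hb := hlt b
    have hidx : ∀ x, x ∉ ord.take (ord.idxOf b) ↔ ord.idxOf b ≤ ord.idxOf x := by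
      intro x
      rw [List.mem_take_iff_idxOf_lt (hmem x), not_lt]
    have := hlab (ord.idxOf b) hb (by omega) c ((hidx c).2 hbc.le)
    rw [hget b] at this
    refine absurd this (not_le.2 ?_)
    have htl : (ord.take (ord.idxOf b)).length = ord.idxOf b := by
      rw [List.length_take]; omega
    refine labelFrom_lt_labelFrom (G := G) (m := 0) (t := ord.idxOf a) (by omega) (by omega) ?_ ?_ ?_
    · simpa [hget] using hac
    · simpa [hget] using hnab
    · intro t' ht' hadj
      rw [List.getElem_take] at hadj ⊢
      refine hcon _ ?_ hadj
      rw [hnd.idxOf_getElem]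
      exact ht'
  · intro v
    have hne : ord ≠ [] := by rintro rfl; simp at hlast
    rw [List.getLast?_eq_some_getLast hne, Option.some.injEq] at hlast
    have h1 := hlt v
    have h2 : ord.idxOf u = ord.length - 1 := by
      rw [← hlast, List.getLast_eq_getElem, hnd.idxOf_getElem]
    show ord.idxOf v ≤ ord.idxOf u
    omega

end Executions

/-! ### Dominating triples -/

section DominatingTriple

variable {V : Type*} {G : SimpleGraph V}

/-- A connected subgraph consisting of walks to a common end vertex. -/
lemma exists_connected_subgraph {T : Set V} {e : V} (w : ∀ x : V, G.Walk x e) (hT : T.Nonempty) :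
    ∃ H : G.Subgraph, H.Connected ∧ T ⊆ H.verts ∧
      ∀ v ∈ H.verts, ∃ x ∈ T, v ∈ (w x).support := by
  obtain ⟨x₀, hx₀⟩ := hT
  have hle : ∀ u x, x ∈ T → u ∈ (w x).support →
      ∃ r : G.Walk u e, r.toSubgraph ≤ ⨆ x : T, (w x).toSubgraph := by
    intro u x hx hu
    obtain ⟨q, r, hqr⟩ := Walk.mem_support_iff_exists_append.1 hu
    refine ⟨r, le_trans ?_ (le_iSup (fun x : T => (w x).toSubgraph) ⟨x, hx⟩)⟩
    show r.toSubgraph ≤ (w x).toSubgraph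
    rw [hqr, Walk.toSubgraph_append]
    exact le_sup_right
  refine ⟨⨆ x : T, (w x).toSubgraph, ?_, ?_, ?_⟩
  · rw [Subgraph.connected_iff_forall_exists_walk_subgraph]
    refine ⟨⟨x₀, ?_⟩, ?_⟩
    · simp only [Subgraph.verts_iSup, Set.mem_iUnion]
      exact ⟨⟨x₀, hx₀⟩, by simp⟩
    intro u v hu hv
    simp only [Subgraph.verts_iSup, Set.mem_iUnion, Walk.mem_verts_toSubgraph] at hu hv
    obtain ⟨x, hx⟩ := hu
    obtain ⟨y, hy⟩ := hv
    obtain ⟨p, hp⟩ := hle u x x.2 hx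
    obtain ⟨q, hq⟩ := hle v y y.2 hy
    refine ⟨p.append q.reverse, ?_⟩
    rw [Walk.toSubgraph_append, Walk.toSubgraph_reverse]
    exact sup_le hp hq
  · intro x hx
    simp only [Subgraph.verts_iSup, Set.mem_iUnion]
    exact ⟨⟨x, hx⟩, by simp⟩
  · intro v hv
    simp only [Subgraph.verts_iSup, Set.mem_iUnion, Walk.mem_verts_toSubgraph] at hv
    obtain ⟨x, hx⟩ := hv
    exact ⟨x, x.2, hx⟩

lemma IsDominatingTarget.exists_dist_le_three (hc : G.Connected) {D : Set V}
    (hD : G.IsDominatingTarget D) (hne : D.Nonempty) {d : ℕ} (hd : ∀ x y, G.dist x y ≤ d + 1)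
    {e e' : V} (hee : d ≤ G.dist e e') : ∃ x ∈ D, G.dist x e ≤ 3 := by
  by_contra! hcon
  choose w hw using fun x => hc.exists_walk_length_eq_dist x e'
  obtain ⟨H, hH, hDH, hHw⟩ := exists_connected_subgraph w hne
  have key : ∀ v ∈ H.verts, 1 < G.dist v e := by
    intro v hv
    obtain ⟨x, hx, hvx⟩ := hHw v hv
    by_contra! hve
    obtain ⟨q, r, hqr⟩ := Walk.mem_support_iff_exists_append.1 hvx
    have h1 := congrArg Walk.length hqr
    rw [Walk.length_append, hw] at h1
    have h2 := G.dist_le q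
    have h3 := G.dist_le r
    have h4 := hcon x hx
    have h5 := hd x e'
    have h6 := hc.dist_triangle (u := x) (v := v) (w := e)
    have h7 := hc.dist_triangle (u := e) (v := v) (w := e')
    rw [dist_comm (u := e) (v := v)] at h7
    omega
  rcases hD H hH hDH e with he | ⟨v, hv, hev⟩
  · have := key e he
    simp at this
  · have := key v hv
    have := dist_eq_one_iff_adj.2 hev.symm
    omega

lemma HasDominatingTriple.exists_dist_le_six (hc : G.Connected) (h : G.HasDominatingTriple)
    {d : ℕ} (hd : ∀ x y, G.dist x y ≤ d + 1) (e e' : Fin 4 → V)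
    (hee : ∀ i, d ≤ G.dist (e i) (e' i)) : ∃ i j, i ≠ j ∧ G.dist (e i) (e j) ≤ 6 := by
  obtain ⟨D, hD3, hD⟩ := h
  have hne : (D : Set V).Nonempty := by
    rw [Finset.coe_nonempty, ← Finset.card_pos]
    omega
  choose f hfD hf using fun i => hD.exists_dist_le_three hc hne hd (hee i)
  obtain ⟨i, -, j, -, hij, hfij⟩ := Finset.exists_ne_map_eq_of_card_lt_of_maps_to
    (s := Finset.univ) (t := D) (f := f) (by simp [hD3]) (fun i _ => hfD i)
  refine ⟨i, j, hij, ?_⟩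
  have h1 := hc.dist_triangle (u := e i) (v := f i) (w := e j)
  have h2 := hf i
  have h3 := hf j
  rw [← hfij] at h3
  rw [dist_comm] at h2
  omega

end DominatingTriple

section Diameter

variable {V : Type*} {G : SimpleGraph V}

lemma Connected.eccent_le_iff_dist_le (hc : G.Connected) {u : V} {d : ℕ} :
    G.eccent u ≤ d ↔ ∀ x, G.dist u x ≤ d := by
  rw [eccent_le_iff]
  refine forall_congr' fun x => ?_
  rw [← (hc.preconnected u x).coe_dist_eq_edist, Nat.cast_le]

lemma Connected.ediam_le_iff_dist_le (hc : G.Connected) {d : ℕ} :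
    G.ediam ≤ d ↔ ∀ x y, G.dist x y ≤ d := by
  rw [ediam_le_iff]
  refine forall_congr' fun x => forall_congr' fun y => ?_
  rw [← (hc.preconnected x y).coe_dist_eq_edist, Nat.cast_le]

variable [Fintype V]

/-- If the last vertex `u` of a LexBFS ordering of a chordal graph has eccentricity at most `d`,
then the vertices of a pair at distance `> d` have distance exactly `d` from `u`. -/
lemma IsChordal.dist_eq_of_lexBFSLast (hG : G.IsChordal) (hc : G.Connected) {s u : V}
    (hu : G.LexBFSLast s u) {d : ℕ} (hd : ∀ x, G.dist u x ≤ d) {a b : V} (hab : d < G.dist a b) :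
    Even d ∧ G.dist u a = d ∧ G.dist a b = d + 1 := by
  obtain ⟨τ, hτ, hlast⟩ := hu.exists_isLexOrdering
  have key : ∀ k a b, G.dist u a ≤ 2 * k + 1 → G.dist u b ≤ 2 * k + 1 → G.dist a b ≤ 2 * k + 1 :=
    fun k a b ha hb => hτ.dist_le_odd hc hG (hlast a) (hlast b) ha hb
  rcases Nat.even_or_odd d with hev | ⟨k, rfl⟩
  · obtain ⟨k, rfl⟩ := hev
    have h1 := key k a b ((hd a).trans (by omega)) ((hd b).trans (by omega))
    refine ⟨⟨k, rfl⟩, ?_, by omega⟩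
    by_contra hne
    have h2 := hd a
    have h3 := hd b
    obtain _ | k := k
    · omega
    by_cases hb : G.dist u b = 0
    · obtain rfl := hc.dist_eq_zero_iff.1 hb
      have := hd a
      rw [dist_comm] at this
      omega
    obtain ⟨c, hcb, hc'⟩ := hc.exists_adj_dist_pred hb
    have h4 := key k a c (by omega) (by omega)
    have h5 := hc.dist_triangle (u := a) (v := c) (w := b)
    have h6 := dist_eq_one_iff_adj.2 hcb
    omega
  · have := key k a b (hd a) (hd b)
    omega

lemma LexBFSLast.dist_le (hc : G.Connected) {s u : V} (hu : G.LexBFSLast s u) (x : V) :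
    G.dist s x ≤ G.dist s u := by
  obtain ⟨τ, hτ, hlast⟩ := hu.exists_isLexOrdering
  exact hτ.dist_le_of_le hc (hlast x)

theorem IsChordal.ediam_eq_of_eccent_eq (hG : G.IsChordal) (hc : G.Connected)
    (hD : G.HasDominatingTriple) {s u v : V} (hu : G.LexBFSLast s u) (hv : G.LexBFSLast u v)
    {d : ℕ} (hd : 10 ≤ d) (he : G.eccent v = d) : G.ediam = d := by
  refine le_antisymm ?_ (he ▸ eccent_le_ediam)
  rw [hc.ediam_le_iff_dist_le]
  by_contra! hcon
  obtain ⟨a, b, hab⟩ := hcon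
  have hvd := hc.eccent_le_iff_dist_le.1 he.le
  have hud : ∀ x, G.dist u x ≤ d := fun x => (hv.dist_le hc x).trans (by
    rw [dist_comm]; exact hvd u)
  have hba : d < G.dist b a := by rwa [dist_comm]
  have hua := hG.dist_eq_of_lexBFSLast hc hu hud hab
  have hub := hG.dist_eq_of_lexBFSLast hc hu hud hba
  have hva := hG.dist_eq_of_lexBFSLast hc hv hvd hab
  have hvb := hG.dist_eq_of_lexBFSLast hc hv hvd hba
  have huv : G.dist u v = d := le_antisymm (hud v) (hua.2.1 ▸ hv.dist_le hc a)
  have hdiam : ∀ x y, G.dist x y ≤ d + 1 := by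
    intro x y
    by_contra! hxy
    have := (hG.dist_eq_of_lexBFSLast hc hu hud (a := x) (b := y) (by omega)).2.2
    omega
  obtain ⟨i, j, hij, h6⟩ := hD.exists_dist_le_six hc hdiam ![a, b, u, v] ![b, a, v, u] (by
    intro i
    fin_cases i
    · exact hab.le
    · exact hba.le
    · exact huv.ge
    · exact (dist_comm (G := G) (u := u) ▸ huv).ge)
  have hvu : G.dist v u = d := by rwa [dist_comm]
  have hau : G.dist a u = d := by rw [dist_comm]; exact hua.2.1
  have hbu : G.dist b u = d := by rw [dist_comm]; exact hub.2.1
  have hav : G.dist a v = d := by rw [dist_comm]; exact hva.2.1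
  have hbv : G.dist b v = d := by rw [dist_comm]; exact hvb.2.1
  have hua' := hua.2.1
  have hub' := hub.2.1
  have hva' := hva.2.1
  have hvb' := hvb.2.1
  clear hua hub hva hvb
  fin_cases i <;> fin_cases j <;> simp at hij h6 <;> omega

end Diameter

end SimpleGraph

namespace RAM

/-! ### A program logic with time bounds -/

/-- Started in `σ`, the program `p` halts within `T` steps in a state that satisfies `Q`. -/
def Runs (p : Prog) (σ : State) (T : ℕ) (Q : State → Prop) : Prop :=
  ∃ t τ, Exec p σ t τ ∧ t ≤ T ∧ Q τ

@[simp] lemma reg_setReg (σ : State) (r x r' : ℕ) :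
    (σ.setReg r x).reg r' = if r' = r then x else σ.reg r' := by
  simp [State.setReg, Function.update_apply]

@[simp] lemma arr_setReg (σ : State) (r x : ℕ) : (σ.setReg r x).arr = σ.arr := rfl

@[simp] lemma reg_setArr (σ : State) (a i x : ℕ) : (σ.setArr a i x).reg = σ.reg := rfl

@[simp] lemma arr_setArr (σ : State) (a i x a' : ℕ) :
    (σ.setArr a i x).arr a' = if a' = a then Function.update (σ.arr a) i x else σ.arr a' := by
  simp [State.setArr, Function.update_apply]

namespace Runs

variable {p q : Prog} {σ : State} {T T' T₁ T₂ : ℕ} {Q Q' : State → Prop} {r s a i c : ℕ} {b : Test}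

lemma mono (h : Runs p σ T Q) (hT : T ≤ T') (hQ : ∀ τ, Q τ → Q' τ) : Runs p σ T' Q' := by
  obtain ⟨t, τ, h1, h2, h3⟩ := h
  exact ⟨t, τ, h1, h2.trans hT, hQ τ h3⟩

lemma seq (h : Runs p σ T₁ fun τ => Runs q τ T₂ Q) : Runs (.seq p q) σ (T₁ + T₂) Q := by
  obtain ⟨t, τ, h1, h2, t', τ', h1', h2', h3⟩ := h
  exact ⟨_, τ', h1.seq h1', by omega, h3⟩

lemma skip (h : Q σ) : Runs .skip σ (T + 1) Q := ⟨1, _, .skip σ, by omega, h⟩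

lemma const (h : Q (σ.setReg r c)) : Runs (.const r c) σ (T + 1) Q :=
  ⟨1, _, .const σ r c, by omega, h⟩

lemma copy (h : Q (σ.setReg r (σ.reg s))) : Runs (.copy r s) σ (T + 1) Q :=
  ⟨1, _, .copy σ r s, by omega, h⟩

lemma succ (h : Q (σ.setReg r (σ.reg s + 1))) : Runs (.succ r s) σ (T + 1) Q :=
  ⟨1, _, .succ σ r s, by omega, h⟩

lemma load (h : Q (σ.setReg r (σ.arr a (σ.reg i)))) : Runs (.load r a i) σ (T + 1) Q :=
  ⟨1, _, .load σ r a i, by omega, h⟩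

lemma store (h : Q (σ.setArr a (σ.reg i) (σ.reg s))) : Runs (.store a i s) σ (T + 1) Q :=
  ⟨1, _, .store σ a i s, by omega, h⟩

lemma const_seq (h : Runs q (σ.setReg r c) T Q) : Runs (.seq (.const r c) q) σ (T + 1) Q := by
  rw [add_comm]; exact seq (const (T := 0) h)

lemma succ_seq (h : Runs q (σ.setReg r (σ.reg s + 1)) T Q) :
    Runs (.seq (.succ r s) q) σ (T + 1) Q := by
  rw [add_comm]; exact seq (succ (T := 0) h)

lemma pred_seq (h : Runs q (σ.setReg r (σ.reg s - 1)) T Q) :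
    Runs (.seq (.pred r s) q) σ (T + 1) Q := by
  obtain ⟨t, τ, h1, h2, h3⟩ := h
  exact ⟨_, τ, (Exec.pred σ r s).seq h1, by omega, h3⟩

lemma load_seq (h : Runs q (σ.setReg r (σ.arr a (σ.reg i))) T Q) :
    Runs (.seq (.load r a i) q) σ (T + 1) Q := by
  rw [add_comm]; exact seq (load (T := 0) h)

lemma store_seq (h : Runs q (σ.setArr a (σ.reg i) (σ.reg s)) T Q) :
    Runs (.seq (.store a i s) q) σ (T + 1) Q := by
  rw [add_comm]; exact seq (store (T := 0) h)

lemma ite (h₁ : b.Holds σ → Runs p σ T Q) (h₂ : ¬ b.Holds σ → Runs q σ T Q) :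
    Runs (.ite b p q) σ (T + 1) Q := by
  by_cases hb : b.Holds σ
  · obtain ⟨t, τ, h1, h2, h3⟩ := h₁ hb
    exact ⟨_, τ, .iteTrue hb h1, by omega, h3⟩
  · obtain ⟨t, τ, h1, h2, h3⟩ := h₂ hb
    exact ⟨_, τ, .iteFalse hb h1, by omega, h3⟩

/-- A loop with `N` passes; `Inv i τ T` says that `τ` may be reached after `i` passes and at most
`T` steps. -/
lemma loop {N B : ℕ} (Inv : ℕ → State → ℕ → Prop) (h₀ : Inv 0 σ 0)
    (hstep : ∀ i < N, ∀ σ T, Inv i σ T → b.Holds σ ∧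
      ∃ T', Runs p σ T' fun τ => Inv (i + 1) τ (T + T' + 1))
    (hend : ∀ τ T, Inv N τ T → ¬ b.Holds τ ∧ T + 1 ≤ B ∧ Q τ) : Runs (.loop b p) σ B Q := by
  have key : ∀ j i, i + j = N → ∀ σ T, Inv i σ T →
      ∃ T' t τ, Exec (.loop b p) σ t τ ∧ t + T ≤ T' + 1 ∧ Inv N τ T' := by
    intro j
    induction j with
    | zero =>
      intro i hi σ T hI
      obtain rfl : i = N := by omega
      exact ⟨T, 1, σ, .loopFalse (hend σ T hI).1, by omega, hI⟩
    | succ j ih =>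
      intro i hi σ T hI
      obtain ⟨hb, T', t, τ, h1, h2, h3⟩ := hstep i (by omega) σ T hI
      obtain ⟨T'', t', τ', h1', h2', h3'⟩ := ih (i + 1) (by omega) τ _ h3
      exact ⟨T'', _, τ', .loopTrue hb h1 h1', by omega, h3'⟩
  obtain ⟨T', t, τ, h1, h2, h3⟩ := key N 0 (by omega) σ 0 h₀
  obtain ⟨-, h4, h5⟩ := hend τ T' h3
  exact ⟨t, τ, h1, by omega, h5⟩

end Runs

/-! ### Loops over vertices and neighbours -/

/-- Run `body` for the values `0, …, n - 1` of register `1`, where `n` is held in register `0`. -/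
def forVertices (body : Prog) : Prog :=
  .seq (.const 1 0) (.loop (.lt 1 0) (.seq body (.succ 1 1)))

lemma Runs.forVertices {body : Prog} {σ : State} {n B : ℕ} {Q : State → Prop}
    (Inv : ℕ → State → ℕ → Prop) (hn : σ.reg 0 = n) (h₀ : Inv 0 (σ.setReg 1 0) 0)
    (hstep : ∀ i < n, ∀ σ T, Inv i σ T → σ.reg 0 = n → σ.reg 1 = i →
      ∃ T', Runs body σ T' fun τ => Inv (i + 1) (τ.setReg 1 (i + 1)) (T + T' + 2) ∧
        τ.reg 0 = n ∧ τ.reg 1 = i)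
    (hend : ∀ τ T, Inv n τ T → τ.reg 0 = n → T + 1 ≤ B ∧ Q τ) :
    Runs (forVertices body) σ (B + 1) Q := by
  refine Runs.const_seq (Runs.loop (N := n)
    (fun i σ T => Inv i σ T ∧ σ.reg 0 = n ∧ σ.reg 1 = i) ⟨h₀, by simp [hn], by simp⟩ ?_ ?_)
  · rintro i hi σ T ⟨h1, h2, h3⟩
    refine ⟨by simp [Test.Holds, h2, h3, hi], ?_⟩
    obtain ⟨T', hT'⟩ := hstep i hi σ T h1 h2 h3
    refine ⟨T' + 1, Runs.seq (hT'.mono le_rfl fun τ hτ => Runs.succ (T := 0) ?_)⟩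
    obtain ⟨h4, h5, h6⟩ := hτ
    rw [h6]
    exact ⟨by convert h4 using 1; omega, by simp [h5], by simp⟩
  · rintro τ T ⟨h1, h2, h3⟩
    obtain ⟨h4, h5⟩ := hend τ T h1 h2
    exact ⟨by simp [Test.Holds, h2, h3], h4, h5⟩

section Input

variable {n : ℕ} (L : Fin n → List (Fin n))

/-- The position where the list `L i` starts. -/
def offset (i : ℕ) : ℕ := ((List.ofFn L).take i).flatten.length

lemma offset_succ (v : Fin n) : offset L (v + 1) = offset L v + (L v).length := by
  have hv : (v : ℕ) < (List.ofFn L).length := by simp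
  simp [offset, List.take_add_one]

lemma getD_flatten (v : Fin n) {j : ℕ} (hj : j < (L v).length) :
    ((List.ofFn L).flatten.map Fin.val).getD (offset L v + j) 0 = ((L v)[j] : ℕ) := by
  have hv : (v : ℕ) < (List.ofFn L).length := by simp
  have h : (List.ofFn L).flatten =
      ((List.ofFn L).take v).flatten ++ (L v ++ ((List.ofFn L).drop (v + 1)).flatten) := by
    conv_lhs => rw [← List.take_append_drop v (List.ofFn L), List.drop_eq_getElem_cons hv]
    simp
  rw [h, List.getD_eq_getElem?_getD, List.getElem?_map,
    List.getElem?_append_right (by simp [offset])]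
  simp only [offset, Nat.add_sub_cancel_left]
  rw [List.getElem?_append_left hj, List.getElem?_eq_getElem hj]
  simp

/-- The memory still holds the input. -/
def HoldsInput (σ : State) : Prop :=
  σ.arr 0 = (inputState L).arr 0 ∧ σ.arr 1 = (inputState L).arr 1

variable {L}

lemma HoldsInput.arr_zero {σ : State} (h : HoldsInput L σ) {i : ℕ} (hi : i ≤ n) :
    σ.arr 0 i = offset L i := by
  rw [h.1]; simp [inputState, offset, hi]

lemma HoldsInput.arr_one {σ : State} (h : HoldsInput L σ) (v : Fin n) {j : ℕ}
    (hj : j < (L v).length) : σ.arr 1 (offset L v + j) = ((L v)[j] : ℕ) := by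
  rw [h.2, ← getD_flatten L v hj]
  simp [inputState]

/-- Run `body` with the neighbours of the vertex in register `v` as values of register `6`. -/
def forNeighbors (v : ℕ) (body : Prog) : Prog :=
  .seq (.load 4 0 v) (.seq (.succ 9 v) (.seq (.load 5 0 9)
    (.loop (.lt 4 5) (.seq (.load 6 1 4) (.seq (.succ 4 4) body)))))

lemma Runs.forNeighbors {body : Prog} {σ : State} {r T : ℕ} {v : Fin n} (J : ℕ → State → Prop)
    (hr : σ.reg r = v) (hr4 : r ≠ 4) (hin : HoldsInput L σ)
    (h₀ : J 0 (((σ.setReg 4 (offset L v)).setReg 9 (v + 1)).setReg 5 (offset L (v + 1))))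
    (hstep : ∀ (j : ℕ) (hj : j < (L v).length) (σ : State), J j σ → HoldsInput L σ →
      σ.reg 5 = offset L (v + 1) →
      Runs body ((σ.setReg 6 ((L v)[j] : ℕ)).setReg 4 (offset L v + j + 1)) T fun τ =>
        J (j + 1) τ ∧ HoldsInput L τ ∧ τ.reg 4 = offset L v + j + 1 ∧
          τ.reg 5 = offset L (v + 1)) :
    Runs (forNeighbors r body) σ ((L v).length * (T + 3) + 4) fun τ =>
      J (L v).length τ ∧ HoldsInput L τ := by
  refine Runs.load_seq (Runs.succ_seq (Runs.load_seq (Runs.loop (N := (L v).length)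
    (fun j σ T' => J j σ ∧ HoldsInput L σ ∧ σ.reg 4 = offset L v + j ∧
      σ.reg 5 = offset L (v + 1) ∧ T' = j * (T + 3)) ?_ ?_ ?_)))
  · have h1 : σ.arr 0 v = offset L v := hin.arr_zero v.2.le
    have h2 : σ.arr 0 (v + 1) = offset L (v + 1) := hin.arr_zero v.2
    simp only [reg_setReg, arr_setReg, hr, hr4, if_true, if_false, h1, h2]
    refine ⟨h₀, hin, by simp, by simp, by simp⟩
  · rintro j hj σ T' ⟨h1, h2, h3, h4, h5⟩
    refine ⟨?_, T + 2, Runs.load_seq (Runs.succ_seq ?_)⟩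
    · simp only [Test.Holds, h3, h4, offset_succ]
      omega
    have h6 := h2.arr_one v hj
    simp only [h3, h6, reg_setReg]
    refine (hstep j hj σ h1 h2 h4).mono le_rfl fun τ hτ => ⟨hτ.1, hτ.2.1, hτ.2.2.1, hτ.2.2.2, ?_⟩
    rw [h5]; ring
  · rintro τ T' ⟨h1, h2, h3, h4, h5⟩
    refine ⟨?_, by omega, h1, h2⟩
    simp [Test.Holds, h3, h4, offset_succ]

end Input

end RAM

/-! ### LexBFS by partition refinement -/

namespace PartitionRefinement

/-- The arrays of the partition refinement algorithm: `A` lists the vertices, `pos` is its inverse,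
the unvisited vertices are partitioned into classes `cls`, each of which is an interval of `A` that
starts at `st`; `mark` and `newc` tell whether and into which new class a class is being split, and
`next` is the first unused name of a class. -/
structure Table where
  A : ℕ → ℕ
  pos : ℕ → ℕ
  cls : ℕ → ℕ
  st : ℕ → ℕ
  mark : ℕ → ℕ
  newc : ℕ → ℕ
  next : ℕ

open Function in
/-- Move the vertex `w` to the front of its class, and there into the new class split off from this
class, unless `w` has been visited up to time `k`. -/
def Table.touch (k w : ℕ) (L : Table) : Table :=
  if k < L.pos w then
    let c := L.cls w
    let i := L.st c
    let j := L.pos w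
    let y := L.A i
    let newc := if L.mark c = k + 1 then L.newc else update L.newc c L.next
    { A := update (update L.A j y) i w
      pos := update (update L.pos y j) w i
      cls := update L.cls w (newc c)
      st := update (if L.mark c = k + 1 then L.st else update L.st L.next i) c (i + 1)
      mark := if L.mark c = k + 1 then L.mark else update L.mark c (k + 1)
      newc := newc
      next := if L.mark c = k + 1 then L.next else L.next + 1 }
  else L

/-- Remove the vertex in position `k` from its class. -/
def Table.enter (k : ℕ) (L : Table) : Table :=
  { L with st := Function.update L.st (L.cls (L.A k)) (k + 1) }

/-- The vertices in positions `≥ lo` are sorted and partitioned according to their labels, where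
`lab t x` tells whether time `t` occurs in the label of `x`. -/
structure Table.Refined (n lo : ℕ) (lab : ℕ → ℕ → Prop) (L : Table) : Prop where
  A_lt : ∀ i < n, L.A i < n
  pos_lt : ∀ v < n, L.pos v < n
  pos_A : ∀ i < n, L.pos (L.A i) = i
  A_pos : ∀ v < n, L.A (L.pos v) = v
  eq_lab : ∀ x < n, ∀ z < n, lo ≤ L.pos x → lo ≤ L.pos z → L.cls x = L.cls z →
    ∀ t < lo, (lab t x ↔ lab t z)
  lt_lab : ∀ x < n, ∀ z < n, lo ≤ L.pos x → L.pos x < L.pos z → L.cls x ≠ L.cls z →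
    ∃ t < lo, lab t x ∧ ¬ lab t z ∧ ∀ t' < t, (lab t' x ↔ lab t' z)
  le_st : ∀ x < n, lo ≤ L.pos x → lo ≤ L.st (L.cls x)
  st_le : ∀ x < n, lo ≤ L.pos x → L.st (L.cls x) ≤ L.pos x
  interval : ∀ x < n, ∀ z < n, lo ≤ L.pos x → L.st (L.cls x) ≤ L.pos z → L.pos z ≤ L.pos x →
    L.cls z = L.cls x
  cls_lt : ∀ x < n, L.cls x < L.next

/-- The labels `lab` up to time `k - 1`, and time `k` in the labels of the vertices in `M`. -/
def extend (k : ℕ) (lab : ℕ → ℕ → Prop) (M : ℕ → Prop) (t x : ℕ) : Prop :=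
  if t < k then lab t x else M x

lemma extend_lt {k t : ℕ} {lab : ℕ → ℕ → Prop} {M : ℕ → Prop} {x : ℕ} (h : t < k) :
    extend k lab M t x ↔ lab t x := by simp [extend, h]

lemma extend_self {k : ℕ} {lab : ℕ → ℕ → Prop} {M : ℕ → Prop} {x : ℕ} :
    extend k lab M k x ↔ M x := by simp [extend]

/-- The state of the marks while the neighbours of the vertex visited at time `k` are treated; those
in `M` have been treated already. -/
structure Table.Splitting (n k : ℕ) (lab : ℕ → ℕ → Prop) (M : ℕ → Prop) (L : Table) : Prop where
  mark_le : ∀ c, L.mark c ≤ k + 1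
  marked : ∀ w < n, ∀ x < n, k < L.pos w → k < L.pos x → ¬ M w → M x →
    (∀ t < k, (lab t w ↔ lab t x)) → L.mark (L.cls w) = k + 1 ∧ L.newc (L.cls w) = L.cls x
  of_marked : ∀ w < n, k < L.pos w → ¬ M w → L.mark (L.cls w) = k + 1 →
    ∃ x < n, M x ∧ k < L.pos x ∧ L.pos x + 1 = L.st (L.cls w) ∧ L.cls x = L.newc (L.cls w) ∧
      ∀ t < k, (lab t w ↔ lab t x)

lemma Table.Refined.congr {n lo : ℕ} {lab lab' : ℕ → ℕ → Prop} {L : Table}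
    (h : L.Refined n lo lab)
    (hl : ∀ t < lo, ∀ x < n, lo ≤ L.pos x → (lab t x ↔ lab' t x)) : L.Refined n lo lab' := by
  refine { h with eq_lab := ?_, lt_lab := ?_ }
  · intro x hx z hz h1 h2 h3 t ht
    rw [← hl t ht x hx h1, ← hl t ht z hz h2]
    exact h.eq_lab x hx z hz h1 h2 h3 t ht
  · intro x hx z hz h1 h2 h3
    obtain ⟨t, ht, h4, h5, h6⟩ := h.lt_lab x hx z hz h1 h2 h3
    refine ⟨t, ht, (hl t ht x hx h1).1 h4, fun h7 => h5 ((hl t ht z hz (by omega)).2 h7), ?_⟩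
    intro t' ht'
    rw [← hl t' (by omega) x hx h1, ← hl t' (by omega) z hz (by omega)]
    exact h6 t' ht'

section Touch

variable {n k w : ℕ} {lab : ℕ → ℕ → Prop} {M : ℕ → Prop} {L : Table}

lemma Table.touch_refined (h : L.Refined n (k + 1) (extend k lab M)) (hs : L.Splitting n k lab M)
    (hw : w < n) (hM : ¬ M w) :
    (L.touch k w).Refined n (k + 1) (extend k lab fun x => M x ∨ x = w) ∧
    (L.touch k w).Splitting n k lab (fun x => M x ∨ x = w) ∧
    (∀ x < n, L.pos x ≤ k → (L.touch k w).pos x = L.pos x) ∧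
    (∀ x < n, k < L.pos x → k < (L.touch k w).pos x) ∧
    ∀ t ≤ k, (L.touch k w).A t = L.A t := by
  by_cases hkw : k < L.pos w
  swap
  · have htouch : L.touch k w = L := by simp [touch, hkw]
    have hMM : ∀ x < n, k < L.pos x → ((M x ∨ x = w) ↔ M x) := by
      intro x hx hkx
      refine or_iff_left ?_
      rintro rfl
      exact hkw hkx
    rw [htouch]
    refine ⟨h.congr ?_, ⟨hs.mark_le, ?_, ?_⟩, fun _ _ _ => rfl, fun _ _ h => h, fun _ _ => rfl⟩
    · intro t ht x hx hkx
      simp only [extend, hMM x hx hkx]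
    · intro w' hw' x hx h1 h2 h3 h4
      rw [hMM _ hw' h1] at h3
      rw [hMM _ hx h2] at h4
      exact hs.marked w' hw' x hx h1 h2 h3 h4
    · intro w' hw' h1 h2 h3
      rw [hMM _ hw' h1] at h2
      obtain ⟨x, hx, h4, h5⟩ := hs.of_marked w' hw' h1 h2 h3
      exact ⟨x, hx, Or.inl h4, h5⟩
  -- The cells involved.
  obtain ⟨c, hc⟩ : ∃ c, c = L.cls w := ⟨_, rfl⟩
  obtain ⟨i, hi⟩ : ∃ i, i = L.st c := ⟨_, rfl⟩
  obtain ⟨j, hj⟩ : ∃ j, j = L.pos w := ⟨_, rfl⟩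
  obtain ⟨y, hy⟩ : ∃ y, y = L.A i := ⟨_, rfl⟩
  obtain ⟨d, hd⟩ : ∃ d, d = if L.mark c = k + 1 then L.newc c else L.next := ⟨_, rfl⟩
  have hkj : k < j := hj ▸ hkw
  have hjn : j < n := hj ▸ h.pos_lt w hw
  have hki : k < i := by
    have := h.le_st w hw hkw
    rw [hi, hc]; omega
  have hij : i ≤ j := by
    rw [hi, hc, hj]; exact h.st_le w hw hkw
  have hyn : y < n := hy ▸ h.A_lt i (by omega)
  have hpy : L.pos y = i := hy ▸ h.pos_A i (by omega)
  have hcy : L.cls y = c := by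
    rw [hc]
    exact h.interval w hw y hyn hkw (by rw [hpy, hi, hc]) (by omega)
  have hinj : ∀ x < n, ∀ z < n, L.pos x = L.pos z → x = z := fun x hx z hz e => by
    rw [← h.A_pos x hx, e, h.A_pos z hz]
  -- The new table.
  have hA' : ∀ p, (L.touch k w).A p = if p = i then w else if p = j then y else L.A p := by
    intro p
    simp only [touch, ← hc, ← hi, ← hj, ← hy, if_pos hkj, Function.update_apply]
  have hpos' : ∀ x, (L.touch k w).pos x = if x = w then i else if x = y then j else L.pos x := by
    intro x
    simp only [touch, ← hc, ← hi, ← hj, ← hy, if_pos hkj, Function.update_apply]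
  have hcls' : ∀ x, (L.touch k w).cls x = if x = w then d else L.cls x := by
    intro x
    simp only [touch, hkw, if_true, Function.update_apply, ← hc]
    by_cases hm : L.mark c = k + 1 <;> simp [hm, hd]
  have hst' : ∀ e, (L.touch k w).st e =
      if e = c then i + 1 else if L.mark c ≠ k + 1 ∧ e = L.next then i else L.st e := by
    intro e
    simp only [touch, hkw, if_true, Function.update_apply, ← hc, ← hi]
    by_cases hm : L.mark c = k + 1 <;> simp [hm, Function.update_apply]
  have hmark' : ∀ e, (L.touch k w).mark e = if e = c then k + 1 else L.mark e := by
    intro e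
    simp only [touch, hkw, if_true, ← hc]
    by_cases hm : L.mark c = k + 1
    · by_cases he : e = c
      · simp [he, hm]
      · simp [hm, he]
    · simp [hm, Function.update_apply]
  have hnewc' : ∀ e, (L.touch k w).newc e = if e = c then d else L.newc e := by
    intro e
    simp only [touch, hkw, if_true, ← hc]
    by_cases hm : L.mark c = k + 1
    · by_cases he : e = c
      · simp [he, hm, hd]
      · simp [hm, he]
    · simp [hm, hd, Function.update_apply]
  have hnext' : (L.touch k w).next = if L.mark c = k + 1 then L.next else L.next + 1 := by
    simp only [touch, hkw, if_true, ← hc]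
  generalize L.touch k w = L' at *
  -- Labels of the vertices in the classes `c` and `d`.
  have hclab : ∀ x < n, k < L.pos x → L.cls x = c → ¬ M x ∧ (∀ t < k, (lab t w ↔ lab t x)) := by
    intro x hx hkx hxc
    have h1 := h.eq_lab w hw x hx hkw hkx (by rw [hxc, hc])
    refine ⟨fun hMx => hM ?_, fun t ht => ?_⟩
    · exact extend_self.1 ((h1 k (by omega)).2 (extend_self.2 hMx))
    · simpa [extend_lt ht] using h1 t (by omega)
  have hcpos : ∀ x < n, k < L.pos x → L.cls x = c → i ≤ L.pos x := by
    intro x hx hkx hxc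
    have := h.st_le x hx hkx
    rwa [hxc, ← hi] at this
  have hnotc : ∀ x < n, i ≤ L.pos x → L.cls x ≠ c → ∀ z < n, k < L.pos z → L.cls z = c →
      L.pos z < L.pos x := by
    intro x hx hix hxc z hz hkz hzc
    by_contra! hle
    refine hxc ?_
    rw [h.interval z hz x hx hkz (by rw [hzc, ← hi]; exact hix) hle, hzc]
  have hdx : L.mark c = k + 1 → ∃ x < n, M x ∧ k < L.pos x ∧ L.pos x + 1 = i ∧ L.cls x = d ∧
      ∀ t < k, (lab t w ↔ lab t x) := by
    intro hm
    obtain ⟨x, hx, h1, h2, h3, h4, h5⟩ := hs.of_marked w hw hkw hM (hc ▸ hm)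
    refine ⟨x, hx, h1, h2, by rw [h3, hi, hc], ?_, h5⟩
    rw [h4, hd, if_pos hm, hc]
  have hcn : c < L.next := hc ▸ h.cls_lt w hw
  have hdc : d ≠ c := by
    by_cases hm : L.mark c = k + 1
    · obtain ⟨x, hx, h1, h2, -, h4, -⟩ := hdx hm
      rintro rfl
      exact (hclab x hx h2 h4).1 h1
    · rw [hd, if_neg hm]; omega
  have hdlab : ∀ x < n, k < L.pos x → L.cls x = d →
      M x ∧ (∀ t < k, (lab t w ↔ lab t x)) ∧ L.pos x < i ∧ L.mark c = k + 1 := by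
    intro x hx hkx hxd
    have hm : L.mark c = k + 1 := by
      by_contra hm
      have := h.cls_lt x hx
      rw [hxd, hd, if_neg hm] at this
      omega
    obtain ⟨x₀, hx₀, h1, h2, h3, h4, h5⟩ := hdx hm
    have h6 := h.eq_lab x₀ hx₀ x hx h2 hkx (by rw [h4, hxd])
    refine ⟨extend_self.1 ((h6 k (by omega)).1 (extend_self.2 h1)), fun t ht => ?_, ?_, hm⟩
    · rw [h5 t ht]
      simpa [extend_lt ht] using h6 t (by omega)
    · by_contra! hix
      have h7 := h.st_le x₀ hx₀ h2
      rw [h4, ← hxd] at h7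
      have h8 := h.interval x hx y hyn hkx (by omega) (by omega)
      exact hdc (by rw [← hxd, ← h8, hcy])
  have hMd : ∀ x < n, k < L.pos x → M x → (∀ t < k, (lab t w ↔ lab t x)) → L.cls x = d := by
    intro x hx hkx hMx hl
    obtain ⟨h1, h2⟩ := hs.marked w hw x hx hkw hkx hM hMx hl
    rw [← hc] at h1 h2
    rw [hd, if_pos h1, h2]
  -- Positions.
  have hkpos : ∀ x < n, (k < L'.pos x ↔ k < L.pos x) := by
    intro x hx
    rw [hpos']
    split_ifs with h1 h2
    · subst h1; omega
    · subst h2; omega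
    · rfl
  have hkpos' : ∀ x < n, (k + 1 ≤ L'.pos x ↔ k < L.pos x) := hkpos
  have hposw : L'.pos w = i := by rw [hpos', if_pos rfl]
  have hclsw : L'.cls w = d := by rw [hcls', if_pos rfl]
  have hclsx : ∀ x, x ≠ w → L'.cls x = L.cls x := fun x hx => by rw [hcls', if_neg hx]
  have hposx : ∀ x < n, x ≠ w → (L'.pos x = L.pos x ∧ x ≠ y) ∨ (x = y ∧ L'.pos x = j ∧ i < j) := by
    intro x hx hxw
    rw [hpos', if_neg hxw]
    split_ifs with h1
    · refine Or.inr ⟨h1, rfl, lt_of_le_of_ne hij fun e => hxw ?_⟩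
      exact hinj x hx w hw (by rw [h1, hpy, e, hj])
    · exact Or.inl ⟨rfl, h1⟩
  have hposi : ∀ x < n, x ≠ w → L'.pos x ≠ i := by
    intro x hx hxw he
    rcases hposx x hx hxw with ⟨h1, h2⟩ | ⟨h1, h2, h3⟩
    · exact h2 (hinj x hx y hyn (by omega))
    · omega
  have hnc : ∀ x < n, x ≠ w → L.cls x ≠ c → L'.pos x = L.pos x := by
    intro x hx hxw hxc
    rcases hposx x hx hxw with ⟨h1, -⟩ | ⟨h1, -⟩
    · exact h1
    · exact absurd (h1 ▸ hcy) hxc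
  have hcc : ∀ x < n, k < L.pos x → x ≠ w → L.cls x = c → i < L'.pos x := by
    intro x hx hkx hxw hxc
    rcases hposx x hx hxw with ⟨h1, h2⟩ | ⟨h1, h2, h3⟩
    · have := hcpos x hx hkx hxc
      have h4 := hposi x hx hxw
      omega
    · omega
  have hsep : ∀ x < n, x ≠ w → L.cls x ≠ c → i ≤ L.pos x → ∀ z < n, k < L.pos z → z ≠ w →
      L.cls z = c → L'.pos z < L'.pos x := by
    intro x hx hxw hxc hix z hz hkz hzw hzc
    have h1 := hnotc x hx hix hxc z hz hkz hzc
    have h2 := hnotc x hx hix hxc w hw hkw hc.symm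
    rw [hnc x hx hxw hxc]
    rcases hposx z hz hzw with ⟨h3, -⟩ | ⟨-, h3, -⟩ <;> omega
  have hext : ∀ t x, x ≠ w → (extend k lab (fun x => M x ∨ x = w) t x ↔ extend k lab M t x) := by
    intro t x hxw
    simp [extend, hxw]
  have hextw : ∀ t < k, (extend k lab (fun x => M x ∨ x = w) t w ↔ extend k lab M t w) := by
    intro t ht
    simp [extend, ht]
  have hextk : extend k lab (fun x => M x ∨ x = w) k w := by simp [extend]
  have hxl : ∀ {M' : ℕ → Prop} {t x}, t < k → (extend k lab M' t x ↔ lab t x) :=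
    fun ht => extend_lt ht
  refine ⟨⟨?_, ?_, ?_, ?_, ?_, ?_, ?_, ?_, ?_, ?_⟩, ⟨?_, ?_, ?_⟩, ?_, ?_, ?_⟩
  · intro p hp
    rw [hA']
    split_ifs
    exacts [hw, hyn, h.A_lt p hp]
  · intro x hx
    rw [hpos']
    split_ifs
    exacts [by omega, by omega, h.pos_lt x hx]
  · intro p hp
    rw [hA']
    split_ifs with h1 h2
    · rw [hposw, h1]
    · have hyw : y ≠ w := by
        rintro rfl
        omega
      rw [hpos', if_neg hyw, if_pos rfl, h2]
    · have h3 := h.pos_A p hp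
      have hpw : L.A p ≠ w := fun e => by rw [e] at h3; omega
      have hpy' : L.A p ≠ y := fun e => by rw [e] at h3; omega
      rw [hpos', if_neg hpw, if_neg hpy', h3]
  · intro x hx
    by_cases hxw : x = w
    · rw [hxw, hposw, hA', if_pos rfl]
    · rcases hposx x hx hxw with ⟨h1, h2⟩ | ⟨h1, h2, h3⟩
      · have h4 := hposi x hx hxw
        rw [hA', if_neg h4, if_neg, h1, h.A_pos x hx]
        rw [h1, hj]
        exact fun e => hxw (hinj x hx w hw e)
      · rw [h2, hA', if_neg h3.ne', if_pos rfl, h1]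
  · -- equal classes have equal labels
    have key : ∀ x < n, k < L.pos x → x ≠ w → L'.cls x = d → ∀ t < k + 1,
        (extend k lab (fun x => M x ∨ x = w) t x ↔ extend k lab (fun x => M x ∨ x = w) t w) := by
      intro x hx hkx hxw hxd t ht
      rw [hclsx x hxw] at hxd
      obtain ⟨h1, h2, -⟩ := hdlab x hx hkx hxd
      rcases Nat.lt_succ_iff_lt_or_eq.1 ht with ht | rfl
      · rw [hxl ht, hxl ht, h2 t ht]
      · exact iff_of_true (extend_self.2 (Or.inl h1)) hextk
    intro x hx z hz h1 h2 h3 t ht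
    rw [hkpos' _ ‹_›] at h1 h2
    by_cases hxw : x = w
    · by_cases hzw : z = w
      · rw [hxw, hzw]
      · rw [hxw] at h3 ⊢
        exact (key z hz h2 hzw (by rw [← h3, hclsw]) t ht).symm
    · by_cases hzw : z = w
      · rw [hzw] at h3 ⊢
        exact key x hx h1 hxw (by rw [h3, hclsw]) t ht
      · rw [hclsx x hxw, hclsx z hzw] at h3
        rw [hext t x hxw, hext t z hzw]
        exact h.eq_lab x hx z hz h1 h2 h3 t ht
  · -- classes are sorted
    intro x hx z hz h1 h2 h3
    have hkz : k < L.pos z := (hkpos z hz).1 (by omega)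
    rw [hkpos' _ hx] at h1
    by_cases hxw : x = w
    · by_cases hzw : z = w
      · rw [hxw, hzw] at h2; omega
      rw [hxw, hclsw, hclsx z hzw] at h3
      rw [hxw, hposw] at h2
      rw [hxw]
      by_cases hzc : L.cls z = c
      · obtain ⟨h4, h5⟩ := hclab z hz hkz hzc
        refine ⟨k, by omega, hextk, ?_, fun t ht => ?_⟩
        · rw [hext k z hzw, extend_self]; exact h4
        · rw [hxl ht, hxl ht, h5 t ht]
      · rw [hnc z hz hzw hzc] at h2
        have h4 := hnotc z hz h2.le hzc w hw hkw hc.symm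
        obtain ⟨t, ht, h5, h6, h7⟩ := h.lt_lab w hw z hz hkw h4 (by rw [← hc]; exact fun e => hzc e.symm)
        have htk : t < k := by
          rcases Nat.lt_succ_iff_lt_or_eq.1 ht with ht | rfl
          · exact ht
          · exact absurd (extend_self.1 h5) hM
        refine ⟨t, ht, (hextw t htk).2 h5, by rwa [hext t z hzw], fun t' ht' => ?_⟩
        rw [hextw t' (by omega), hext t' z hzw]
        exact h7 t' ht'
    · by_cases hzw : z = w
      · rw [hzw, hclsw, hclsx x hxw] at h3
        rw [hzw, hposw] at h2
        rw [hzw]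
        have hxc : L.cls x ≠ c := fun hxc => by
          have := hcc x hx h1 hxw hxc
          omega
        rw [hnc x hx hxw hxc] at h2
        obtain ⟨t, ht, h5, h6, h7⟩ := h.lt_lab x hx w hw h1 (by omega) (by rwa [← hc])
        have htk : t < k := by
          rcases Nat.lt_succ_iff_lt_or_eq.1 ht with ht | rfl
          · exact ht
          · exfalso
            refine h3 (hMd x hx h1 (extend_self.1 h5) fun t' ht' => ?_)
            have := h7 t' ht'
            rw [hxl ht', hxl ht'] at this
            exact this.symm
        refine ⟨t, ht, by rwa [hext t x hxw], by rwa [hextw t htk], fun t' ht' => ?_⟩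
        rw [hextw t' (by omega), hext t' x hxw]
        exact h7 t' ht'
      · rw [hclsx x hxw, hclsx z hzw] at h3
        have h4 : L.pos x < L.pos z := by
          by_cases hxc : L.cls x = c
          · have hzc : L.cls z ≠ c := fun e => h3 (by rw [hxc, e])
            have h5 := hcc x hx h1 hxw hxc
            rw [hnc z hz hzw hzc] at h2
            exact hnotc z hz (by omega) hzc x hx h1 hxc
          · rw [hnc x hx hxw hxc] at h2
            by_cases hzc : L.cls z = c
            · by_contra! hle
              have h5 := hcpos z hz hkz hzc
              have h6 := hsep x hx hxw hxc (by omega) z hz hkz hzw hzc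
              rw [hnc x hx hxw hxc] at h6
              omega
            · rwa [hnc z hz hzw hzc] at h2
        obtain ⟨t, ht, h5, h6, h7⟩ := h.lt_lab x hx z hz h1 h4 h3
        refine ⟨t, ht, by rwa [hext t x hxw], by rwa [hext t z hzw], fun t' ht' => ?_⟩
        rw [hext t' x hxw, hext t' z hzw]
        exact h7 t' ht'
  · intro x hx h1
    rw [hkpos' _ hx] at h1
    rw [hst']
    split_ifs with h2 h3
    · omega
    · omega
    · by_cases hxw : x = w
      · rw [hxw, hclsw] at h3 ⊢
        have hm : L.mark c = k + 1 := by
          by_contra hm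
          exact h3 ⟨hm, by rw [hd, if_neg hm]⟩
        obtain ⟨x₀, hx₀, -, h4, -, h5, -⟩ := hdx hm
        rw [← h5]
        exact h.le_st x₀ hx₀ h4
      · rw [hclsx x hxw]
        exact h.le_st x hx h1
  · intro x hx h1
    rw [hkpos' _ hx] at h1
    by_cases hxw : x = w
    · rw [hxw, hclsw, hposw, hst', if_neg hdc]
      split_ifs with h3
      · exact le_rfl
      · have hm : L.mark c = k + 1 := by
          by_contra hm
          exact h3 ⟨hm, by rw [hd, if_neg hm]⟩
        obtain ⟨x₀, hx₀, -, h4, h6, h5, -⟩ := hdx hm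
        have := h.st_le x₀ hx₀ h4
        rw [h5] at this
        omega
    · rw [hclsx x hxw, hst']
      have hxn := h.cls_lt x hx
      split_ifs with h3 h4
      · exact hcc x hx h1 hxw h3
      · omega
      · rw [hnc x hx hxw h3]
        exact h.st_le x hx h1
  · intro x hx z hz h1 h2 h3
    rw [hkpos' _ hx] at h1
    by_cases hzw : z = w
    · rw [hzw, hposw] at h2 h3
      rw [hzw, hclsw]
      by_cases hxw : x = w
      · rw [hxw, hclsw]
      rw [hclsx x hxw] at h2 ⊢
      have hxn := h.cls_lt x hx
      by_cases hxc : L.cls x = c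
      · rw [hst', if_pos hxc] at h2
        omega
      · rw [hst', if_neg hxc, if_neg (by omega)] at h2
        rw [hnc x hx hxw hxc] at h3
        have := h.interval x hx y hyn h1 (by omega) (by omega)
        exact absurd (by rw [← this, hcy]) hxc
    · rw [hclsx z hzw]
      by_cases hxw : x = w
      · rw [hxw, hclsw, hst', if_neg hdc] at h2
        rw [hxw, hposw] at h3
        rw [hxw, hclsw]
        have h4 := hposi z hz hzw
        split_ifs at h2 with h5
        · omega
        · have hm : L.mark c = k + 1 := by
            by_contra hm
            exact h5 ⟨hm, by rw [hd, if_neg hm]⟩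
          obtain ⟨x₀, hx₀, -, h6, h7, h8, -⟩ := hdx hm
          rcases hposx z hz hzw with ⟨h9, -⟩ | ⟨-, h9, -⟩
          · rw [← h8]
            exact h.interval x₀ hx₀ z hz h6 (by rw [h8]; omega) (by omega)
          · omega
      · rw [hclsx x hxw] at h2 ⊢
        have hxn := h.cls_lt x hx
        by_cases hxc : L.cls x = c
        · rw [hst', if_pos hxc] at h2
          rw [hxc]
          by_contra hzc
          rw [hnc z hz hzw hzc] at h2
          have := hsep z hz hzw hzc (by omega) x hx h1 hxw hxc
          omega
        · rw [hst', if_neg hxc, if_neg (by omega)] at h2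
          rw [hnc x hx hxw hxc] at h3
          rcases hposx z hz hzw with ⟨h9, -⟩ | ⟨-, h9, -⟩
          · exact h.interval x hx z hz h1 (by omega) (by omega)
          · have := h.interval x hx w hw h1 (by omega) (by omega)
            exact absurd (by rw [← this, hc]) hxc
  · intro x hx
    rw [hnext']
    by_cases hxw : x = w
    · rw [hxw, hclsw]
      split_ifs with hm
      · obtain ⟨x₀, hx₀, -, -, -, h8, -⟩ := hdx hm
        rw [← h8]
        exact h.cls_lt x₀ hx₀
      · rw [hd, if_neg hm]; omega
    · rw [hclsx x hxw]
      have := h.cls_lt x hx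
      split_ifs <;> omega
  · intro e
    rw [hmark']
    have := hs.mark_le e
    split_ifs <;> omega
  · intro w' hw' x hx h1 h2 h3 h4 h5
    rw [hkpos _ ‹_›] at h1 h2
    have hw'w : w' ≠ w := fun e => h3 (Or.inr e)
    have hw'M : ¬ M w' := fun e => h3 (Or.inl e)
    rw [hclsx w' hw'w, hmark', hnewc']
    by_cases hxw : x = w
    · have hw'c : L.cls w' = c := by
        by_contra hne
        have hcon : ∀ t < k + 1, (extend k lab M t w' ↔ extend k lab M t w) := by
          intro t ht
          rcases Nat.lt_succ_iff_lt_or_eq.1 ht with ht | rfl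
          · rw [hxl ht, hxl ht, h5 t ht, hxw]
          · exact iff_of_false (fun e => hw'M (extend_self.1 e)) (fun e => hM (extend_self.1 e))
        rcases lt_trichotomy (L.pos w) (L.pos w') with hlt | heq | hgt
        · obtain ⟨t, ht, h6, h7, -⟩ := h.lt_lab w hw w' hw' hkw hlt (by rw [← hc]; exact fun e => hne e.symm)
          exact h7 ((hcon t ht).2 h6)
        · exact hw'w (hinj w' hw' w hw heq.symm)
        · obtain ⟨t, ht, h6, h7, -⟩ := h.lt_lab w' hw' w hw h1 hgt (by rwa [← hc])
          exact h7 ((hcon t ht).1 h6)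
      rw [if_pos hw'c, if_pos hw'c, hxw, hclsw]
      exact ⟨rfl, rfl⟩
    · have hMx := h4.resolve_right hxw
      obtain ⟨h6, h7⟩ := hs.marked w' hw' x hx h1 h2 hw'M hMx h5
      rw [hclsx x hxw]
      split_ifs with h8
      · refine ⟨rfl, ?_⟩
        rw [h8] at h6 h7
        rw [hd, if_pos h6, h7]
      · exact ⟨h6, h7⟩
  · intro w' hw' h1 h3 h4
    rw [hkpos _ ‹_›] at h1
    have hw'w : w' ≠ w := fun e => h3 (Or.inr e)
    have hw'M : ¬ M w' := fun e => h3 (Or.inl e)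
    rw [hclsx w' hw'w] at h4 ⊢
    rw [hmark'] at h4
    rw [hnewc', hst']
    have hw'n := h.cls_lt w' hw'
    by_cases hw'c : L.cls w' = c
    · rw [if_pos hw'c, if_pos hw'c]
      refine ⟨w, hw, Or.inr rfl, by omega, by omega, hclsw, fun t ht => ?_⟩
      exact ((hclab w' hw' h1 hw'c).2 t ht).symm
    · rw [if_neg hw'c] at h4
      rw [if_neg hw'c, if_neg hw'c, if_neg (by omega)]
      obtain ⟨x, hx, h5, h6, h7, h8, h9⟩ := hs.of_marked w' hw' h1 hw'M h4
      have hxw : x ≠ w := by rintro rfl; exact hM h5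
      have hxc : L.cls x ≠ c := fun e => (hclab x hx h6 e).1 h5
      refine ⟨x, hx, Or.inl h5, (hkpos x hx).2 h6, ?_, ?_, h9⟩
      · rw [hnc x hx hxw hxc, h7]
      · rw [hclsx x hxw, h8]
  · intro x hx hxk
    rw [hpos', if_neg, if_neg]
    · rintro rfl; omega
    · rintro rfl; omega
  · intro x hx hxk
    exact (hkpos x hx).2 hxk
  · intro t ht
    rw [hA', if_neg (by omega), if_neg (by omega)]

end Touch

end PartitionRefinement

namespace PartitionRefinement

/-- The order of the vertices visited up to time `k` is preserved. -/
structure Table.Keeps (n k : ℕ) (L L' : Table) : Prop where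
  pos_eq : ∀ x < n, L.pos x ≤ k → L'.pos x = L.pos x
  lt_pos : ∀ x < n, k < L.pos x → k < L'.pos x
  A_eq : ∀ t ≤ k, L'.A t = L.A t

lemma Table.Keeps.trans {n k : ℕ} {L L' L'' : Table} (h : L.Keeps n k L') (h' : L'.Keeps n k L'') :
    L.Keeps n k L'' where
  pos_eq x hx hk := by rw [h'.pos_eq x hx (by rw [h.pos_eq x hx hk]; exact hk), h.pos_eq x hx hk]
  lt_pos x hx hk := h'.lt_pos x hx (h.lt_pos x hx hk)
  A_eq t ht := by rw [h'.A_eq t ht, h.A_eq t ht]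

/-- The state after `k` vertices of the graph with adjacency relation `R` have been visited. -/
structure Table.Visited (n : ℕ) (R : ℕ → ℕ → Prop) (k : ℕ) (L : Table) : Prop where
  refined : L.Refined n k fun t x => R (L.A t) x
  mark_le : ∀ c, L.mark c ≤ k
  exists_private : ∀ a < n, ∀ b < n, ∀ c < n, L.pos a < L.pos b → L.pos b < L.pos c →
    L.pos b < k → R a c → ¬ R a b → ∃ d < n, L.pos d < L.pos a ∧ R d b ∧ ¬ R d c

variable {n k : ℕ} {R : ℕ → ℕ → Prop} {L L' : Table}

lemma Table.visited_zero (hA : ∀ i < n, L.A i = i) (hpos : ∀ i < n, L.pos i = i)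
    (hcls : ∀ x, L.cls x = 0) (hst : L.st 0 = 0) (hmark : ∀ c, L.mark c = 0) (hnext : L.next = 1) :
    L.Visited n R 0 := by
  refine ⟨⟨?_, ?_, ?_, ?_, ?_, ?_, ?_, ?_, ?_, ?_⟩, fun c => (hmark c).le, ?_⟩
  · intro i hi; rwa [hA i hi]
  · intro i hi; rwa [hpos i hi]
  · intro i hi; rw [hA i hi, hpos i hi]
  · intro i hi; rw [hpos i hi, hA i hi]
  · intro x _ z _ _ _ _ t ht; omega
  · intro x _ z _ _ _ hne; simp [hcls] at hne
  · intro x _ _; omega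
  · intro x _ _; simp [hcls, hst]
  · intro x _ z _ _ _ _; simp [hcls]
  · intro x _; simp [hcls, hnext]
  · intro a _ b _ c _ _ _ hb; omega

lemma Table.Visited.enter (h : L.Visited n R k) (hk : k < n) :
    (L.enter k).Refined n (k + 1) (extend k (fun t x => R (L.A t) x) fun _ => False) ∧
    (L.enter k).Splitting n k (fun t x => R (L.A t) x) (fun _ => False) ∧
    L.Keeps n k (L.enter k) := by
  have hr := h.refined
  obtain ⟨v, hv⟩ : ∃ v, v = L.A k := ⟨_, rfl⟩
  have hvn : v < n := hv ▸ hr.A_lt k hk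
  have hpv : L.pos v = k := hv ▸ hr.pos_A k hk
  have hst : ∀ e, (L.enter k).st e = if e = L.cls v then k + 1 else L.st e := by
    intro e
    simp [Table.enter, Function.update_apply, hv]
  have hcls : (L.enter k).cls = L.cls := rfl
  have hpos : (L.enter k).pos = L.pos := rfl
  have hmark : (L.enter k).mark = L.mark := rfl
  refine ⟨⟨hr.A_lt, hr.pos_lt, hr.pos_A, hr.A_pos, ?_, ?_, ?_, ?_, ?_, hr.cls_lt⟩,
    ⟨?_, ?_, ?_⟩, ⟨fun _ _ _ => rfl, fun _ _ h => h, fun _ _ => rfl⟩⟩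
  · intro x hx z hz h1 h2 h3 t ht
    rw [hpos] at h1 h2
    rcases Nat.lt_succ_iff_lt_or_eq.1 ht with ht | rfl
    · rw [extend_lt ht, extend_lt ht]
      exact hr.eq_lab x hx z hz (by omega) (by omega) h3 t ht
    · rw [extend_self, extend_self]
  · intro x hx z hz h1 h2 h3
    rw [hpos] at h1 h2
    obtain ⟨t, ht, h4, h5, h6⟩ := hr.lt_lab x hx z hz (by omega) h2 h3
    refine ⟨t, by omega, (extend_lt ht).2 h4, fun h7 => h5 ((extend_lt ht).1 h7), fun t' ht' => ?_⟩
    rw [extend_lt (by omega), extend_lt (by omega)]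
    exact h6 t' ht'
  · intro x hx h1
    rw [hpos] at h1
    rw [hcls, hst]
    split_ifs with h2
    · rfl
    · have h3 := hr.le_st x hx (by omega)
      by_contra h4
      have h5 := hr.interval x hx v hvn (by omega) (by omega) (by omega)
      exact h2 h5.symm
  · intro x hx h1
    rw [hpos] at h1
    rw [hcls, hst, hpos]
    split_ifs with h2
    · exact h1
    · exact hr.st_le x hx (by omega)
  · intro x hx z hz h1 h2 h3
    rw [hpos] at h1 h2 h3
    rw [hcls] at h2 ⊢
    refine hr.interval x hx z hz (by omega) ?_ h3
    rw [hst] at h2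
    split_ifs at h2 with h4
    · have h5 := hr.st_le v hvn (by omega)
      rw [h4]
      omega
    · exact h2
  · intro c
    have := h.mark_le c
    rw [hmark]
    omega
  · intro w _ x _ _ _ _ hf
    exact hf.elim
  · intro w _ _ _ hm
    have := h.mark_le ((L.enter k).cls w)
    rw [hmark] at hm
    omega

lemma Table.Visited.succ (h : L.Visited n R k) (hkeep : L.Keeps n k L')
    (hr : L'.Refined n (k + 1) (extend k (fun t x => R (L.A t) x) (R (L.A k))))
    (hmark : ∀ c, L'.mark c ≤ k + 1) : L'.Visited n R (k + 1) := by
  have hle : ∀ x < n, L'.pos x ≤ k → L.pos x = L'.pos x := by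
    intro x hx hk
    by_cases h1 : L.pos x ≤ k
    · exact (hkeep.pos_eq x hx h1).symm
    · have := hkeep.lt_pos x hx (by omega)
      omega
  have hlt : ∀ x < n, k < L'.pos x → k < L.pos x := by
    intro x hx hk
    by_contra! h1
    have := hkeep.pos_eq x hx h1
    omega
  refine ⟨hr.congr ?_, hmark, ?_⟩
  · intro t ht x hx _
    rw [hkeep.A_eq t (by omega)]
    rcases Nat.lt_succ_iff_lt_or_eq.1 ht with ht | rfl
    · rw [extend_lt ht]
    · rw [extend_self]
  · intro a ha b hb c hc hab hbc hbk hac hnab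
    have hpa := hle a ha (by omega)
    have hpb := hle b hb (by omega)
    have hbc' : L.pos b < L.pos c := by
      by_cases hck : L'.pos c ≤ k
      · rw [hpb, hle c hc hck]; exact hbc
      · have := hlt c hc (by omega)
        omega
    have hd : ∃ d < n, L.pos d < L.pos a ∧ R d b ∧ ¬ R d c := by
      rcases Nat.lt_succ_iff_lt_or_eq.1 hbk with hbk | hbk
      · exact h.exists_private a ha b hb c hc (by omega) hbc' (by omega) hac hnab
      · by_cases hcls : L.cls b = L.cls c
        · have := h.refined.eq_lab b hb c hc (by omega) (by omega) hcls (L.pos a) (by omega)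
          rw [h.refined.A_pos a ha] at this
          exact absurd (this.2 hac) hnab
        · obtain ⟨t, ht, h1, h2, h3⟩ := h.refined.lt_lab b hb c hc (by omega) hbc' hcls
          have htn : t < n := by have := h.refined.pos_lt b hb; omega
          refine ⟨L.A t, h.refined.A_lt t htn, ?_, h1, h2⟩
          rw [h.refined.pos_A t htn]
          by_contra! hle'
          rcases hle'.eq_or_lt with heq | hlt'
          · rw [← heq, h.refined.A_pos a ha] at h1
            exact hnab h1
          · have := h3 _ hlt'
            rw [h.refined.A_pos a ha] at this
            exact hnab (this.2 hac)
    obtain ⟨d, hdn, hda, hdb, hdc⟩ := hd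
    refine ⟨d, hdn, ?_, hdb, hdc⟩
    rw [hkeep.pos_eq d hdn (by omega)]
    omega

end PartitionRefinement

namespace RAM

open PartitionRefinement

/-! ### The program for LexBFS -/

/-- The table of the partition refinement algorithm as it is stored in memory. -/
def table (σ : State) : Table where
  A := σ.arr 2
  pos := σ.arr 3
  cls := σ.arr 4
  st := σ.arr 5
  mark := σ.arr 6
  newc := σ.arr 7
  next := σ.reg 8

/-- Treat the vertex in register `6` as a neighbour of the vertex visited at the time in
register `1`. -/
def touchProg : Prog :=
  .seq (.load 11 3 6) (.ite (.lt 1 11)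
    (.seq (.load 7 4 6) (.seq (.load 9 6 7) (.seq (.load 10 5 7) (.seq
      (.ite (.ne 9 2)
        (.seq (.store 6 7 2) (.seq (.store 7 7 8) (.seq (.store 5 8 10) (.succ 8 8))))
        .skip)
      (.seq (.load 12 2 10) (.seq (.store 2 11 12) (.seq (.store 3 12 11) (.seq (.store 2 10 6)
        (.seq (.store 3 6 10) (.seq (.load 9 7 7) (.seq (.store 4 6 9) (.seq (.succ 10 10)
          (.store 5 7 10)))))))))))))
    .skip)

lemma runs_touchProg (σ : State) (h2 : σ.reg 2 = σ.reg 1 + 1) :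
    Runs touchProg σ 19 fun τ => table τ = (table σ).touch (σ.reg 1) (σ.reg 6) ∧
      (∀ r < 6, τ.reg r = σ.reg r) ∧ ∀ a, a < 2 ∨ 7 < a → τ.arr a = σ.arr a := by
  refine Runs.load_seq (Runs.ite (fun hb => ?_) (fun hb => ?_))
  · have hb' : σ.reg 1 < σ.arr 3 (σ.reg 6) := by simpa [Test.Holds] using hb
    refine Runs.load_seq (Runs.load_seq (Runs.load_seq (Runs.seq (T₁ := 5) (T₂ := 9)
      (Runs.ite (fun hm => ?_) (fun hm => ?_)))))
    · have hm' : ¬ σ.arr 6 (σ.arr 4 (σ.reg 6)) = σ.reg 1 + 1 := by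
        simpa [Test.Holds, h2] using hm
      refine Runs.store_seq (Runs.store_seq (Runs.store_seq (Runs.succ (T := 0) ?_)))
      refine Runs.load_seq (Runs.store_seq (Runs.store_seq (Runs.store_seq (Runs.store_seq
        (Runs.load_seq (Runs.store_seq (Runs.succ_seq (Runs.store (T := 0) ?_))))))))
      refine ⟨?_, ?_, ?_⟩
      · simp [table, Table.touch, hb', hm', h2]
      · intro r hr
        interval_cases r <;> simp
      · intro a ha
        rcases ha with ha | ha
        · interval_cases a <;> simp
        · have e2 : a ≠ 2 := by omega
          have e3 : a ≠ 3 := by omega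
          have e4 : a ≠ 4 := by omega
          have e5 : a ≠ 5 := by omega
          have e6 : a ≠ 6 := by omega
          have e7 : a ≠ 7 := by omega
          simp [e2, e3, e4, e5, e6, e7]
    · have hm' : σ.arr 6 (σ.arr 4 (σ.reg 6)) = σ.reg 1 + 1 := by
        simpa [Test.Holds, h2] using hm
      refine Runs.skip ?_
      refine Runs.load_seq (Runs.store_seq (Runs.store_seq (Runs.store_seq (Runs.store_seq
        (Runs.load_seq (Runs.store_seq (Runs.succ_seq (Runs.store (T := 0) ?_))))))))
      refine ⟨?_, ?_, ?_⟩
      · simp [table, Table.touch, hb', hm']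
      · intro r hr
        interval_cases r <;> simp
      · intro a ha
        rcases ha with ha | ha
        · interval_cases a <;> simp
        · have e2 : a ≠ 2 := by omega
          have e3 : a ≠ 3 := by omega
          have e4 : a ≠ 4 := by omega
          have e5 : a ≠ 5 := by omega
          simp [e2, e3, e4, e5]
  · have hb' : ¬ σ.reg 1 < σ.arr 3 (σ.reg 6) := by simpa [Test.Holds] using hb
    refine Runs.skip ⟨?_, ?_, ?_⟩
    · simp [table, Table.touch, hb']
    · intro r hr
      interval_cases r <;> simp
    · intro a _
      simp

/-- Visit the vertex in the position held in register `1`. -/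
def visitProg : Prog :=
  .seq (.load 3 2 1) (.seq (.load 7 4 3) (.seq (.succ 2 1) (.seq (.store 5 7 2)
    (forNeighbors 3 touchProg))))

/-- LexBFS, with start vertex `0`. -/
def lexBFSProg : Prog :=
  .seq (forVertices (.seq (.store 2 1 1) (.store 3 1 1)))
    (.seq (.const 8 1) (forVertices visitProg))

section

variable {n : ℕ} {G : SimpleGraph (Fin n)} {L : Fin n → List (Fin n)}

/-- Adjacency of the vertices named by two natural numbers. -/
def natAdj (G : SimpleGraph (Fin n)) (x y : ℕ) : Prop :=
  ∃ (hx : x < n) (hy : y < n), G.Adj ⟨x, hx⟩ ⟨y, hy⟩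

/-- The length of the list of the vertex named by a natural number. -/
def natDegree (L : Fin n → List (Fin n)) (x : ℕ) : ℕ :=
  if h : x < n then (L ⟨x, h⟩).length else 0

lemma runs_visitProg (hL : IsAdjacencyLists G L) {σ : State} {k : ℕ} (hk : k < n)
    (h1 : σ.reg 1 = k) (h0 : σ.reg 0 = n) (hin : HoldsInput L σ)
    (hV : (table σ).Visited n (natAdj G) k) :
    Runs visitProg σ (natDegree L (σ.arr 2 k) * 22 + 8) fun τ =>
      (table τ).Visited n (natAdj G) (k + 1) ∧ HoldsInput L τ ∧ τ.reg 0 = n ∧ τ.reg 1 = k ∧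
        (∀ t ≤ k, τ.arr 2 t = σ.arr 2 t) ∧ ∀ a, 7 < a → τ.arr a = σ.arr a := by
  have hvn : σ.arr 2 k < n := hV.refined.A_lt k hk
  obtain ⟨v, hv⟩ : ∃ v : Fin n, (v : ℕ) = σ.arr 2 k := ⟨⟨_, hvn⟩, rfl⟩
  have hdeg : natDegree L (σ.arr 2 k) = (L v).length := by
    rw [← hv, natDegree, dif_pos v.2]
  obtain ⟨he1, he2, he3⟩ := hV.enter hk
  refine Runs.load_seq (Runs.load_seq (Runs.succ_seq (Runs.store_seq ?_)))
  rw [hdeg]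
  refine (Runs.forNeighbors (v := v) (T := 19) (J := fun j τ =>
    (table τ).Refined n (k + 1) (extend k (fun t x => natAdj G (σ.arr 2 t) x)
      fun x => x ∈ ((L v).take j).map Fin.val) ∧
    (table τ).Splitting n k (fun t x => natAdj G (σ.arr 2 t) x)
      (fun x => x ∈ ((L v).take j).map Fin.val) ∧
    (table σ).Keeps n k (table τ) ∧ τ.reg 0 = n ∧ τ.reg 1 = k ∧ τ.reg 2 = k + 1 ∧
    ∀ a, 7 < a → τ.arr a = σ.arr a) ?_ (by decide) ?_ ?_ ?_).mono le_rfl ?_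
  · simp [h1, hv]
  · simpa [HoldsInput] using hin
  · have htab : ∀ ρ : State, ρ.arr = (σ.setArr 5 (σ.arr 4 (σ.arr 2 k)) (k + 1)).arr →
        ρ.reg 8 = σ.reg 8 → table ρ = (table σ).enter k := by
      intro ρ hρ hρ8
      simp [table, Table.enter, hρ, hρ8]
    rw [htab _ (by simp [State.setArr, h1]) (by simp)]
    simp only [List.take_zero, List.map_nil, List.not_mem_nil]
    refine ⟨he1, he2, he3, ?_, ?_, ?_, ?_⟩
    · simp [h0]
    · simp [h1]
    · simp [h1]
    · intro a ha
      have : a ≠ 5 := by omega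
      simp [this]
  · rintro j hj τ ⟨h1, h2, h3, h4, h5, h6, h7⟩ hin' hr5
    have hnd := (hL v).1
    have hw : ((L v)[j] : ℕ) ∉ ((L v).take j).map Fin.val := by
      rw [List.mem_map]
      rintro ⟨x, hx, hxj⟩
      rw [Fin.val_inj] at hxj
      subst hxj
      obtain ⟨i, hi, hij⟩ := List.mem_iff_getElem.1 hx
      rw [List.getElem_take] at hij
      rw [List.length_take] at hi
      have := (hnd.getElem_inj_iff).1 hij
      omega
    have hMM : (fun x => x ∈ ((L v).take (j + 1)).map Fin.val) =
        fun x => x ∈ ((L v).take j).map Fin.val ∨ x = ((L v)[j] : ℕ) := by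
      funext x
      rw [List.take_add_one, List.getElem?_eq_getElem hj]
      simp only [Option.toList_some, List.map_append, List.map_cons, List.map_nil, List.mem_append,
        List.mem_singleton]
    obtain ⟨t1, t2, t3, t4, t5⟩ := Table.touch_refined h1 h2 (L v)[j].2 hw
    refine (runs_touchProg _ ?_).mono le_rfl ?_
    · simp [h5, h6]
    · rintro ρ ⟨q1, q2, q3⟩
      have htab : table ((τ.setReg 6 ((L v)[j] : ℕ)).setReg 4 (offset L v + j + 1)) = table τ := by
        simp [table]
      have hρ : table ρ = (table τ).touch k ((L v)[j] : ℕ) := by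
        rw [q1, htab]
        simp [h5]
      rw [hMM, hρ]
      refine ⟨⟨t1, t2, h3.trans ⟨t3, t4, t5⟩, ?_, ?_, ?_, ?_⟩, ?_, ?_, ?_⟩
      · rw [q2 0 (by omega)]; simpa using h4
      · rw [q2 1 (by omega)]; simpa using h5
      · rw [q2 2 (by omega)]; simpa using h6
      · intro a ha
        rw [q3 a (Or.inr ha), ← h7 a ha]
        simp
      · constructor
        · rw [q3 0 (by omega), ← hin'.1]; simp
        · rw [q3 1 (by omega), ← hin'.2]; simp
      · rw [q2 4 (by omega)]; simp
      · rw [q2 5 (by omega)]; simpa using hr5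
  · rintro τ ⟨⟨h1', h2', h3', h4', h5', h6', h7'⟩, hin'⟩
    have hM : ∀ x < n, (x ∈ ((L v).take (L v).length).map Fin.val ↔ natAdj G (σ.arr 2 k) x) := by
      intro x hx
      rw [List.take_length, List.mem_map, ← hv]
      constructor
      · rintro ⟨y, hy, rfl⟩
        exact ⟨v.2, y.2, ((hL v).2 y).1 hy⟩
      · rintro ⟨_, _, h⟩
        exact ⟨⟨x, hx⟩, ((hL v).2 _).2 h, rfl⟩
    refine ⟨hV.succ h3' (h1'.congr ?_) h2'.mark_le, hin', h4', h5', h3'.A_eq, h7'⟩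
    intro t ht x hx _
    rcases Nat.lt_succ_iff_lt_or_eq.1 ht with ht | rfl
    · rw [extend_lt ht, extend_lt ht]; rfl
    · rw [extend_self, extend_self]; exact hM x hx

end

end RAM

namespace RAM

open PartitionRefinement

section

variable {n : ℕ} {G : SimpleGraph (Fin n)} {L : Fin n → List (Fin n)}

lemma sum_natDegree_range (L : Fin n → List (Fin n)) :
    ∑ t ∈ Finset.range n, natDegree L t = ∑ v, (L v).length := by
  rw [Finset.sum_range]
  exact Finset.sum_congr rfl fun v _ => by rw [natDegree, dif_pos v.2]

lemma sum_length_eq (hL : IsAdjacencyLists G L) : ∑ v, (L v).length = 2 * G.edgeSet.ncard := by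
  classical
  have h1 : ∀ v, (L v).length = G.degree v := by
    intro v
    rw [← List.toFinset_card_of_nodup (hL v).1, ← SimpleGraph.card_neighborFinset_eq_degree]
    congr 1
    ext w
    rw [List.mem_toFinset, SimpleGraph.mem_neighborFinset, (hL v).2]
  rw [Finset.sum_congr rfl fun v _ => h1 v, SimpleGraph.sum_degrees_eq_twice_card_edges,
    ← SimpleGraph.coe_edgeFinset, Set.ncard_coe_finset]

lemma runs_lexBFSProg (hL : IsAdjacencyLists G L) :
    Runs lexBFSProg (inputState L) (14 * n + 22 * ∑ v, (L v).length + 5) fun τ =>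
      (table τ).Visited n (natAdj G) n ∧ HoldsInput L τ ∧ τ.reg 0 = n ∧
        ∀ a, 7 < a → τ.arr a = fun _ => 0 := by
  have hin : ∀ a, 1 < a → (inputState L).arr a = fun _ => 0 := by
    intro a ha
    funext i
    have h0 : a ≠ 0 := by omega
    have h1 : a ≠ 1 := by omega
    simp [inputState, h0, h1]
  have hB : 14 * n + 22 * ∑ v, (L v).length + 5 =
      (4 * n + 1 + 1) + (22 * ∑ v, (L v).length + 10 * n + 1 + 1 + 1) := by ring
  rw [hB]
  refine Runs.seq (Runs.forVertices (n := n) (fun i σ T => (∀ x < i, σ.arr 2 x = x ∧ σ.arr 3 x = x) ∧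
    (∀ a, a ≠ 2 → a ≠ 3 → σ.arr a = (inputState L).arr a) ∧ T = 4 * i) ?_ ?_ ?_ ?_)
  · simp [inputState]
  · exact ⟨by simp, by simp, rfl⟩
  · rintro i hi σ T ⟨h1, h2, h3⟩ h4 h5
    refine ⟨2, Runs.store_seq (Runs.store (T := 0) ⟨⟨?_, ?_, by omega⟩, ?_, ?_⟩)⟩
    · intro x hx
      simp only [arr_setReg, arr_setArr, reg_setArr, h5]
      simp only [if_true, Nat.reduceEqDiff, if_false]
      by_cases hxi : x = i
      · simp [hxi]
      · have := h1 x (by omega)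
        simp [hxi, this]
    · intro a h6 h7
      simp [h6, h7, h2 a h6 h7]
    · simpa using h4
    · simpa using h5
  rintro σ T ⟨h1, h2, h3⟩ h4
  refine ⟨by omega, Runs.const_seq (Runs.forVertices (n := n) (fun k σ T =>
    (table σ).Visited n (natAdj G) k ∧ HoldsInput L σ ∧ (∀ a, 7 < a → σ.arr a = fun _ => 0) ∧
    T = ∑ t ∈ Finset.range k, (22 * natDegree L (σ.arr 2 t) + 10)) ?_ ?_ ?_ ?_)⟩
  · simpa using h4
  · refine ⟨?_, ?_, ?_, by simp⟩
    · apply Table.visited_zero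
      · intro i hi; exact (h1 i hi).1
      · intro i hi; exact (h1 i hi).2
      · intro x; show σ.arr 4 x = 0; rw [h2 4 (by decide) (by decide), hin 4 (by decide)]
      · show σ.arr 5 0 = 0; rw [h2 5 (by decide) (by decide), hin 5 (by decide)]
      · intro x; show σ.arr 6 x = 0; rw [h2 6 (by decide) (by decide), hin 6 (by decide)]
      · simp [table]
    · exact ⟨h2 0 (by decide) (by decide), h2 1 (by decide) (by decide)⟩
    · intro a ha
      exact (h2 a (by omega) (by omega)).trans (hin a (by omega))
  · rintro k hk σ T ⟨h1, h2, h3, hT⟩ h4 h5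
    refine ⟨_, (runs_visitProg hL hk h5 h4 h2 h1).mono le_rfl ?_⟩
    rintro τ ⟨q1, q2, q3, q4, q5, q6⟩
    refine ⟨⟨q1, q2, fun a ha => (q6 a ha).trans (h3 a ha), ?_⟩, q3, q4⟩
    rw [Finset.sum_range_succ, hT]
    have : ∀ t ∈ Finset.range k, 22 * natDegree L (σ.arr 2 t) + 10 =
        22 * natDegree L (τ.arr 2 t) + 10 := fun t ht => by
      rw [q5 t (by have := Finset.mem_range.1 ht; omega)]
    rw [Finset.sum_congr rfl this]
    simp only [arr_setReg, q5 k le_rfl]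
    omega
  · rintro τ T ⟨h1, h2, h3, hT⟩ h4
    refine ⟨?_, h1, h2, h4, h3⟩
    have hr := h1.refined
    have hsum : ∑ t ∈ Finset.range n, natDegree L (τ.arr 2 t) =
        ∑ t ∈ Finset.range n, natDegree L t := by
      refine Finset.sum_nbij' (τ.arr 2) (τ.arr 3) ?_ ?_ ?_ ?_ ?_
      · intro i hi; exact Finset.mem_range.2 (hr.A_lt i (Finset.mem_range.1 hi))
      · intro i hi; exact Finset.mem_range.2 (hr.pos_lt i (Finset.mem_range.1 hi))
      · intro i hi; exact hr.pos_A i (Finset.mem_range.1 hi)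
      · intro i hi; exact hr.A_pos i (Finset.mem_range.1 hi)
      · intro i _; rfl
    rw [hT, Finset.sum_add_distrib, ← Finset.mul_sum, hsum, sum_natDegree_range]
    simp
    omega

lemma isLexOrdering_of_visited {T : Table} (h : T.Visited n (natAdj G) n) (s : Fin n)
    (hs : T.A 0 = s) : G.IsLexOrdering s fun v => T.pos v := by
  have hr := h.refined
  have hn : 0 < n := Fin.pos s
  refine ⟨?_, ?_, ?_⟩
  · intro x y hxy
    have := congrArg T.A hxy
    simp only [hr.A_pos x x.2, hr.A_pos y y.2] at this
    exact Fin.ext this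
  · intro v
    show T.pos s ≤ T.pos v
    rw [← hs, hr.pos_A 0 hn]
    exact Nat.zero_le _
  · intro a b c hab hbc hac hnab
    obtain ⟨d, hd, h1, h2, h3⟩ := h.exists_private a a.2 b b.2 c c.2 hab hbc (hr.pos_lt b b.2)
      ⟨a.2, c.2, hac⟩ (fun ⟨_, _, h⟩ => hnab h)
    obtain ⟨_, _, h2⟩ := h2
    exact ⟨⟨d, hd⟩, h1, h2, fun h4 => h3 ⟨_, _, h4⟩⟩

/-! ### Growing balls -/

/-- Mark in array `a + 1` the vertices marked in array `a` and their neighbours. -/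
def growProg (a : ℕ) : Prog :=
  .seq (.const 13 0) (.seq (.const 14 1) (forVertices
    (.seq (.load 3 a 1) (.ite (.lt 13 3)
      (.seq (.store (a + 1) 1 14) (forNeighbors 1 (.store (a + 1) 6 14)))
      .skip))))

lemma runs_growProg (hL : IsAdjacencyLists G L) {a : ℕ} (ha : 1 < a) {σ : State} {P : Fin n → Prop}
    (hin : HoldsInput L σ) (h0 : σ.reg 0 = n) (hP : ∀ v : Fin n, σ.arr a v ≠ 0 ↔ P v)
    (hz : ∀ b, a < b → σ.arr b = fun _ => 0) :
    Runs (growProg a) σ (10 * n + 4 * ∑ v, (L v).length + 4) fun τ =>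
      HoldsInput L τ ∧ τ.reg 0 = n ∧
      (∀ v : Fin n, τ.arr (a + 1) v ≠ 0 ↔ ∃ w, P w ∧ (w = v ∨ G.Adj w v)) ∧
      ∀ b, a + 1 < b → τ.arr b = fun _ => 0 := by
  have ha0 : 0 ≠ a + 1 := by omega
  have ha1 : 1 ≠ a + 1 := by omega
  have haa : a ≠ a + 1 := by omega
  refine Runs.const_seq (Runs.const_seq (Runs.forVertices (n := n) (fun i σ T =>
    HoldsInput L σ ∧ (∀ v : Fin n, σ.arr a v ≠ 0 ↔ P v) ∧
    (∀ v : Fin n, σ.arr (a + 1) v ≠ 0 ↔ ∃ w : Fin n, (w : ℕ) < i ∧ P w ∧ (w = v ∨ G.Adj w v)) ∧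
    (∀ b, a + 1 < b → σ.arr b = fun _ => 0) ∧ σ.reg 13 = 0 ∧ σ.reg 14 = 1 ∧
    T ≤ ∑ t ∈ Finset.range i, (4 * natDegree L t + 10)) ?_ ?_ ?_ ?_))
  · simpa using h0
  · refine ⟨by simpa [HoldsInput] using hin, by simpa using hP, ?_, ?_, by simp, by simp, by simp⟩
    · simp [hz (a + 1) (by omega)]
    · intro b hb
      simpa using hz b (by omega)
  · rintro i hi σ T ⟨h1, h2, h3, h4, h5, h6, h7⟩ h8 h9
    obtain ⟨v, hv⟩ : ∃ v : Fin n, (v : ℕ) = i := ⟨⟨i, hi⟩, rfl⟩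
    have hdeg : natDegree L i = (L v).length := by rw [← hv, natDegree, dif_pos v.2]
    refine ⟨4 * natDegree L i + 8, Runs.load_seq (T := 4 * natDegree L i + 7)
      (Runs.ite (T := 4 * natDegree L i + 6) (fun hb => ?_) (fun hb => ?_))⟩
    · have hPv : P v := by
        rw [← h2 v, hv]
        simp only [Test.Holds, reg_setReg, h5, h9] at hb
        simpa [Nat.pos_iff_ne_zero] using hb
      refine Runs.store_seq (T := 4 * natDegree L i + 5) ?_
      refine (Runs.forNeighbors (L := L) (v := v) (T := 1) (J := fun j τ =>
        (∀ v : Fin n, τ.arr a v ≠ 0 ↔ P v) ∧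
        (∀ x : Fin n, τ.arr (a + 1) x ≠ 0 ↔ (∃ w : Fin n, (w : ℕ) < i ∧ P w ∧ (w = x ∨ G.Adj w x)) ∨
          x = v ∨ x ∈ (L v).take j) ∧
        (∀ b, a + 1 < b → τ.arr b = fun _ => 0) ∧ τ.reg 13 = 0 ∧ τ.reg 14 = 1 ∧
        τ.reg 0 = n ∧ τ.reg 1 = i) ?_ (by decide) ?_ ?_ ?_).mono (by rw [hdeg]; omega) ?_
      · simp [h9, hv]
      · simpa [HoldsInput, ha0, ha1, show a ≠ 0 by omega] using h1
      · refine ⟨?_, ?_, ?_, ?_, ?_, ?_, ?_⟩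
        · intro x
          simpa [haa] using h2 x
        · intro x
          simp only [arr_setReg, arr_setArr, reg_setReg, if_true, List.take_zero, List.not_mem_nil,
            or_false, Function.update_apply]
          simp only [Nat.reduceEqDiff, OfNat.one_ne_ofNat, if_false, h9, h6]
          by_cases hxv : x = v
          · simp [hxv, hv]
          · have : (x : ℕ) ≠ i := fun e => hxv (Fin.ext (e.trans hv.symm))
            simpa [this, hxv] using h3 x
        · intro b hb
          have : b ≠ a + 1 := by omega
          simpa [this] using h4 b hb
        · simpa using h5
        · simpa using h6
        · simpa using h8
        · simpa using h9
      · rintro j hj τ ⟨q1, q2, q3, q4, q5, q6, q7⟩ q8 q9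
        refine Runs.store (T := 0) ⟨⟨?_, ?_, ?_, ?_, ?_, ?_, ?_⟩, ?_, ?_, ?_⟩
        · intro x
          simpa [haa] using q1 x
        · intro x
          rw [List.take_add_one, List.getElem?_eq_getElem hj, List.mem_append]
          have := q2 x
          by_cases hx : x = (L v)[j]
          · simp [hx, q5]
          · have hx' : (x : ℕ) ≠ ((L v)[j] : ℕ) := fun e => hx (Fin.ext e)
            simpa [Function.update_apply, hx, hx'] using this
        · intro b hb
          have : b ≠ a + 1 := by omega
          simpa [this] using q3 b hb
        · simpa using q4
        · simpa using q5
        · simpa using q6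
        · simpa using q7
        · simpa [HoldsInput, ha0, ha1, show a ≠ 0 by omega] using q8
        · simp
        · simpa using q9
      · rintro τ ⟨⟨q1, q2, q3, q4, q5, q6, q7⟩, q8⟩
        refine ⟨⟨by simpa [HoldsInput] using q8, by simpa using q1, ?_, by simpa using q3,
          by simpa using q4, by simpa using q5, ?_⟩, q6, q7⟩
        · intro x
          rw [arr_setReg, q2 x, List.take_length, (hL v).2]
          constructor
          · rintro (⟨w, hw, hw'⟩ | rfl | hx)
            · exact ⟨w, by omega, hw'⟩
            · exact ⟨x, by omega, hPv, Or.inl rfl⟩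
            · exact ⟨v, by omega, hPv, Or.inr hx⟩
          · rintro ⟨w, hw, hw', hx⟩
            rcases Nat.lt_succ_iff_lt_or_eq.1 hw with hw | hw
            · exact Or.inl ⟨w, hw, hw', hx⟩
            · obtain rfl : w = v := Fin.ext (hw.trans hv.symm)
              exact Or.inr (hx.imp Eq.symm id)
        · rw [Finset.sum_range_succ]
          omega
    · have hPv : ¬ P v := by
        rw [← h2 v, hv]
        simp only [Test.Holds, reg_setReg, h5, h9] at hb
        simpa using hb
      refine Runs.skip (T := 4 * natDegree L i + 5) ⟨⟨by simpa [HoldsInput] using h1, by simpa using h2, ?_,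
        by simpa using h4, by simpa using h5, by simpa using h6, ?_⟩, by simpa using h8,
        by simpa using h9⟩
      · intro x
        simp only [arr_setReg]
        rw [h3 x]
        refine exists_congr fun w => and_congr_left fun hw => ?_
        constructor
        · intro h; omega
        · intro h
          rcases Nat.lt_succ_iff_lt_or_eq.1 h with h | h
          · exact h
          · obtain rfl : w = v := Fin.ext (h.trans hv.symm)
            exact absurd hw.1 hPv
      · rw [Finset.sum_range_succ]
        omega
  · rintro τ T ⟨h1, h2, h3, h4, h5, h6, h7⟩ h8
    rw [Finset.sum_add_distrib, ← Finset.mul_sum, sum_natDegree_range] at h7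
    simp only [Finset.sum_const, Finset.card_range, smul_eq_mul] at h7
    refine ⟨by omega, h1, h8, ?_, h4⟩
    intro v
    rw [h3 v]
    exact exists_congr fun w => and_iff_right w.2

/-- Grow the ball in array `a` by `r` rounds; the result is in array `a + r`. -/
def growBallProg (a : ℕ) : ℕ → Prog
  | 0 => .skip
  | r + 1 => .seq (growBallProg a r) (growProg (a + r))

lemma runs_growBallProg (hL : IsAdjacencyLists G L) (hc : G.Connected) {a : ℕ} (ha : 1 < a)
    {σ : State} {u : Fin n} (hin : HoldsInput L σ) (h0 : σ.reg 0 = n)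
    (hu : ∀ v : Fin n, σ.arr a v ≠ 0 ↔ v = u) (hz : ∀ b, a < b → σ.arr b = fun _ => 0) (r : ℕ) :
    Runs (growBallProg a r) σ (1 + r * (10 * n + 4 * ∑ v, (L v).length + 4)) fun τ =>
      HoldsInput L τ ∧ τ.reg 0 = n ∧ (∀ v : Fin n, τ.arr (a + r) v ≠ 0 ↔ G.dist u v ≤ r) ∧
      ∀ b, a + r < b → τ.arr b = fun _ => 0 := by
  induction r with
  | zero =>
    refine (Runs.skip (T := 0) ⟨hin, h0, ?_, hz⟩).mono (by simp) fun _ h => h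
    intro v
    rw [add_zero, hu, Nat.le_zero, hc.dist_eq_zero_iff, eq_comm]
  | succ r ih =>
    rw [add_mul, ← add_assoc, one_mul]
    refine Runs.seq (ih.mono le_rfl ?_)
    rintro τ ⟨h1, h2, h3, h4⟩
    refine (runs_growProg hL (by omega) h1 h2 h3 h4).mono le_rfl ?_
    rintro ρ ⟨q1, q2, q3, q4⟩
    refine ⟨q1, q2, ?_, q4⟩
    intro v
    rw [← add_assoc, q3 v]
    constructor
    · rintro ⟨w, hw, rfl | hwv⟩
      · omega
      · have := hc.dist_le_succ_of_adj u hwv.symm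
        omega
    · intro hv
      by_cases hv0 : G.dist u v = 0
      · exact ⟨v, by omega, Or.inl rfl⟩
      · obtain ⟨w, hwv, hw⟩ := hc.exists_adj_dist_pred hv0
        exact ⟨w, by omega, Or.inr hwv⟩

/-- Is some vertex not marked in array `a`? -/
def unmarkedProg (a : ℕ) : Prog :=
  .seq (.const 13 0) (.seq (.const 15 0) (.seq (forVertices
    (.seq (.load 3 a 1) (.ite (.lt 13 3) .skip (.const 15 1)))) (.copy 0 15)))

open Classical in
lemma runs_unmarkedProg {a : ℕ} {σ : State} {P : Fin n → Prop} (h0 : σ.reg 0 = n)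
    (hP : ∀ v : Fin n, σ.arr a v ≠ 0 ↔ P v) :
    Runs (unmarkedProg a) σ (5 * n + 5) fun τ => τ.reg 0 = if ∃ v, ¬ P v then 1 else 0 := by
  refine Runs.const_seq (T := 5 * n + 4) (Runs.const_seq (T := 5 * n + 3)
    (Runs.seq (T₁ := 5 * n + 2) (T₂ := 1) (Runs.forVertices (n := n) (fun i σ T =>
    (∀ v : Fin n, σ.arr a v ≠ 0 ↔ P v) ∧ σ.reg 13 = 0 ∧
    (σ.reg 15 = if ∃ v : Fin n, (v : ℕ) < i ∧ ¬ P v then 1 else 0) ∧ T = 5 * i) ?_ ?_ ?_ ?_)))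
  · simpa using h0
  · exact ⟨by simpa using hP, by simp, by simp, rfl⟩
  · rintro i hi σ T ⟨h1, h2, h3, h4⟩ h5 h6
    obtain ⟨v, hv⟩ : ∃ v : Fin n, (v : ℕ) = i := ⟨⟨i, hi⟩, rfl⟩
    have hlt : ∀ w : Fin n, (w : ℕ) < i + 1 ↔ (w : ℕ) < i ∨ w = v := by
      intro w
      rw [Nat.lt_succ_iff_lt_or_eq, ← hv, Fin.val_inj]
    refine ⟨3, Runs.load_seq (T := 2) (Runs.ite (T := 1) (fun hb => ?_) (fun hb => ?_))⟩
    · have hPv : P v := by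
        rw [← h1 v, hv]
        simp only [Test.Holds, reg_setReg, h2, h6] at hb
        simpa [Nat.pos_iff_ne_zero] using hb
      refine Runs.skip (T := 0) ⟨⟨by simpa using h1, by simpa using h2, ?_, by omega⟩,
        by simpa using h5, by simpa using h6⟩
      have : (∃ w : Fin n, (w : ℕ) < i + 1 ∧ ¬ P w) ↔ ∃ w : Fin n, (w : ℕ) < i ∧ ¬ P w := by
        refine exists_congr fun w => and_congr_left fun hw => ?_
        rw [hlt]
        exact or_iff_left (by rintro rfl; exact hw hPv)
      simp only [reg_setReg, this]
      simpa using h3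
    · have hPv : ¬ P v := by
        rw [← h1 v, hv]
        simp only [Test.Holds, reg_setReg, h2, h6] at hb
        simpa using hb
      refine Runs.const (T := 0) ⟨⟨by simpa using h1, by simpa using h2, ?_, by omega⟩,
        by simpa using h5, by simpa using h6⟩
      have : ∃ w : Fin n, (w : ℕ) < i + 1 ∧ ¬ P w := ⟨v, by omega, hPv⟩
      rw [if_pos this]
      simp
  · rintro τ T ⟨h1, h2, h3, h4⟩ h5
    refine ⟨by omega, Runs.copy (T := 0) ?_⟩
    have : (∃ w : Fin n, (w : ℕ) < n ∧ ¬ P w) ↔ ∃ w : Fin n, ¬ P w :=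
      exists_congr fun w => and_iff_right w.2
    simpa [this] using h3

/-! ### Deciding whether the diameter of a chordal graph is at least `2 * k + 2` -/

/-- Run LexBFS, and check whether the vertex visited last has eccentricity at least `r + 1`. -/
def lastEccentProg (r : ℕ) : Prog :=
  .seq lexBFSProg (.seq (.pred 3 0) (.seq (.load 3 2 3) (.seq (.const 14 1) (.seq (.store 10 3 14)
    (.seq (growBallProg 10 r) (unmarkedProg (10 + r)))))))

open Classical in
lemma runs_lastEccentProg (hL : IsAdjacencyLists G L) (hc : G.Connected) (r : ℕ) :
    ∃ (s u : Fin n) (τ : Fin n → ℕ), G.IsLexOrdering s τ ∧ (∀ v, τ v ≤ τ u) ∧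
      Runs (lastEccentProg r) (inputState L)
        ((14 * n + 22 * ∑ v, (L v).length + 5) + ((1 + r * (10 * n + 4 * ∑ v, (L v).length + 4)) +
          (5 * n + 5) + 4)) fun ρ => ρ.reg 0 = if ∃ v, ¬ G.dist u v ≤ r then 1 else 0 := by
  have hn : 0 < n := by
    obtain ⟨v⟩ := hc.nonempty
    exact Fin.pos v
  obtain ⟨t, ρ, hex, ht, h1, h2, h3, h4⟩ := runs_lexBFSProg hL
  have hr := h1.refined
  have hAlast := hr.A_lt (n - 1) (by omega)
  obtain ⟨u, hu⟩ : ∃ u : Fin n, (u : ℕ) = ρ.arr 2 (n - 1) := ⟨⟨_, hAlast⟩, rfl⟩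
  refine ⟨⟨(table ρ).A 0, hr.A_lt 0 hn⟩, u, _, isLexOrdering_of_visited h1 _ rfl, ?_, ?_⟩
  · intro v
    have h5 := hr.pos_lt v v.2
    have h6 : (table ρ).pos u = n - 1 := by
      rw [hu]
      exact hr.pos_A (n - 1) (by omega)
    show (table ρ).pos v ≤ (table ρ).pos u
    omega
  refine Runs.seq ⟨t, ρ, hex, ht, ?_⟩
  refine Runs.pred_seq (Runs.load_seq (Runs.const_seq (Runs.store_seq (Runs.seq ?_))))
  refine (runs_growBallProg (u := u) hL hc (by omega) ?_ ?_ ?_ ?_ r).mono le_rfl ?_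
  · simpa [HoldsInput] using h2
  · simpa using h3
  · intro v
    simp only [arr_setReg, arr_setArr, reg_setReg, if_true, h3, h4 10 (by omega)]
    rw [← hu]
    simp [Function.update_apply, Fin.val_inj]
  · intro b hb
    have : b ≠ 10 := by omega
    simpa [this] using h4 b (by omega)
  · rintro τ ⟨q1, q2, q3, q4⟩
    convert runs_unmarkedProg q2 q3

theorem decidableInLinearTime_even_le_ediam (k : ℕ) :
    DecidableInLinearTime
      (fun _ G => G.Connected ∧ G.IsChordal ∧ G.HasDominatingTriple)
      (fun _ G => ((2 * k + 2 : ℕ) : ℕ∞) ≤ G.ediam) := by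
  refine ⟨lastEccentProg (2 * k + 1), 100 * (2 * k + 2), ?_⟩
  rintro n G ⟨hc, hG, -⟩ L hL
  have hn : 0 < n := by
    obtain ⟨v⟩ := hc.nonempty
    exact Fin.pos v
  obtain ⟨s, u, τ, hτ, hlast, t, ρ, hex, ht, hρ⟩ := runs_lastEccentProg hL hc (2 * k + 1)
  refine ⟨t, ρ, hex, ht.trans ?_, ?_⟩
  · rw [sum_length_eq hL]
    generalize G.edgeSet.ncard = m
    have h1 : n * k ≥ k := Nat.le_mul_of_pos_left k hn
    nlinarith [Nat.zero_le (m * k)]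
  · rw [hρ]
    congr 1
    have h1 : ((2 * k + 2 : ℕ) : ℕ∞) ≤ G.ediam ↔ ¬ G.ediam ≤ ((2 * k + 1 : ℕ) : ℕ∞) := by
      rw [not_le, ← ENat.add_one_le_iff (ENat.natCast_ne_top _)]
      norm_cast
    show (∃ v, ¬ G.dist u v ≤ 2 * k + 1) = (((2 * k + 2 : ℕ) : ℕ∞) ≤ G.ediam)
    rw [h1, hc.ediam_le_iff_dist_le, eq_iff_iff, ← not_forall, not_iff_not]
    constructor
    · intro h x y
      exact hτ.dist_le_odd hc hG (hlast x) (hlast y) (h x) (h y)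
    · intro h v
      exact h u v

end

end RAM

theorem mainTheorem3 :
    (∀ (V : Type*) [Fintype V] (G : SimpleGraph V),
      G.Connected → G.IsChordal → G.HasDominatingTriple →
      ∀ s u v w : V, G.ThreeSweepLexBFS s u v w →
      ∀ d : ℕ, 10 ≤ d →
        (G.eccent v = d → G.ediam = d) ∧ (G.eccent w = d → G.ediam = d)) ∧
    RAM.DecidableInLinearTime
      (fun _ G => G.Connected ∧ G.IsChordal ∧ G.HasDominatingTriple)
      (fun _ G => 10 ≤ G.ediam) := by
  refine ⟨fun V _ G hc hG hD s u v w h d hd => ⟨fun he => ?_, fun he => ?_⟩, ?_⟩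
  · exact hG.ediam_eq_of_eccent_eq hc hD h.1 h.2.1 hd he
  · exact hG.ediam_eq_of_eccent_eq hc hD h.2.1 h.2.2 hd he
  · exact RAM.decidableInLinearTime_even_le_ediam 4
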